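/- Write $\mathbb B=\{0,1\}$, $\ell(p)$ for the length of a string $p$, $x_{1:n}$ for the first $n$ bits of $x$, and $\log=\log_2$. A prefix machine is a partial computable function $V:\mathbb B^*\times\mathbb B^*\to\mathbb B^*$ such that for every $y$ no program in $\{p:V(p,y)\text{ is defined}\}$ is a proper prefix of another. Let $U$ be an optimal prefix machine: for every prefix machine $V$ there is a constant $c_V$ such that whenever $V(p,y)=x$ there is $q$ with $U(q,y)=x$ and $\ell(q)\le\ell(p)+c_V$. Put $K(x|y)=\min\{\ell(p):U(p,y)=x\}$ and $K(x)=K(x|\epsilon)$, where $\epsilon$ is the empty string; $K(x,y)$ is the complexity of a standard string encoding of the pair $(x,y)$. For a constant $c\ge 0$ let $d_K(x,y)=\max\{K(x|y),K(y|x)\}+c$ if $x\ne y$, and $d_K(x,x)=0$. Let $(V,d)$ be a metric space. Functions $\phi_s:V\to\mathbb B^*$ ($s=1,2,\dots$) form a string-embedding of $V$ into $(\mathbb B^*,d_K)$ if there are constants $C,B$ with $$|d_K(\phi_s(v),\phi_s(v'))-s\,d(v,v')|\le C\log s+B\qquad\text{for all }s\ge1,\ v,v'\in V.$$ A function $\phi:V\to\mathbb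 B^\infty$ is a sequence-embedding with length function $f:\mathbb N\times V\to\mathbb N$ if $f(s,v)$ is monotone increasing in $s$, is bounded by a polynomial in $s$ uniformly in $v$, and the functions $\phi_s(v):=\phi(v)_{1:f(s,v)}$ form a string-embedding. A sequence $x\in\mathbb B^\infty$ is $K$-random if $K(x_{1:n})\ge n-O(1)$, and $y,z\in\mathbb B^\infty$ are $K$-independent if $K(y_{1:n},z_{1:n})=K(y_{1:n})+K(z_{1:n})\pm O(\log n)$, where as above the error is understood to be at most $C\log n+B$ for all $n\ge 1$. **Theorem.** Let $a\le b$ be arbitrary (possibly incomputable) real numbers. The interval $[a,b]$ with the distance $|\cdot|$ has a string-embedding and a sequence-embedding into $(\mathbb B^*,d_K)$. More precisely, let $L=\lceil b\rceil-\lfloor a\rfloor$ and, for $r\in[a,b]$, $\rho(r)=(r-\lfloor a\rfloor)/L\in[0,1]$ (with $\rho(r)=0$ if $L=0$). There exist $K$-random $K$-independent sequences $y,z\in\mathbb B^\infty$, and for any such $y,z$ the following hold. 1. For $s\ge 0$ and $r\in[0,1]$ let $x^{r,s}=y_{<t}\,z_{t:s}\in\mathbb B^s$ with $t=\lceil rs\rceil$,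 that is, the $i$-th bit ($1\le i\le s$) is $y_i$ if $i<t$ and $z_i$ if $i\ge t$. Then $\phi_s(r)=x^{\rho(r),\,sL}$ is a string-embedding of $[a,b]$. (For $[a,b]=[0,1]$ this is $\phi_s(r)=x^{r,s}$.) 2. Let $\gamma$ be any computable irrational number whose continued fraction has bounded partial quotients, and let $u_i=i\gamma\bmod 1$ for $i\ge1$. For $r\in[0,1]$ let $x^r\in\mathbb B^\infty$ be the sequence with $x^r_i=z_i$ if $u_i\le r$ and $x^r_i=y_i$ otherwise. Then $\phi(r)=x^{\rho(r)}$ is a sequence-embedding of $[a,b]$ with length function $f(s,r)=sL$. (For $[a,b]=[0,1]$: $\phi(r)=x^r$ and $f(s,r)=s$.) -/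

import Mathlib

/-! ### Strings, sequences and prefix Kolmogorov complexity -/

/-- Finite binary strings. -/
abbrev BitString : Type := List Bool

/-- Infinite binary sequences; `x i` is the bit number `i + 1` of `x`. -/
abbrev BitSeq : Type := ℕ → Bool

/-- The string of the first `n` bits of the sequence `x`. -/
def seqPrefix (x : BitSeq) (n : ℕ) : BitString :=
  (List.range n).map x

/-- A (conditional) prefix machine: a partial computable map taking a program `p` and a side
information `y` to an output string, such that for every fixed `y` the set of halting programs is
prefix-free. -/
structure IsPrefixMachine (V : BitString → BitString →. BitString) : Prop where
  partrec : Partrec₂ V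
  prefixFree : ∀ y p q : BitString, (V p y).Dom → (V q y).Dom → p <+: q → p = q

/-- An optimal (universal) prefix machine: it simulates every prefix machine with programs that are
longer by at most an additive constant. -/
structure IsOptimalPrefixMachine (U : BitString → BitString →. BitString) : Prop
    extends IsPrefixMachine U where
  optimal : ∀ V : BitString → BitString →. BitString, IsPrefixMachine V →
    ∃ c : ℕ, ∀ p y x : BitString, x ∈ V p y →
      ∃ q : BitString, q.length ≤ p.length + c ∧ x ∈ U q y

/-- Conditional prefix complexity `K(x|y)`, the length of a shortest program for `x` given `y`.
If `U` is optimal, such programs exist for all `x` and `y`. -/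
noncomputable def condK (U : BitString → BitString →. BitString) (x y : BitString) : ℕ :=
  sInf {n : ℕ | ∃ p : BitString, p.length = n ∧ x ∈ U p y}

/-- Prefix complexity `K(x)`: the side information is the empty string. -/
noncomputable def prefixK (U : BitString → BitString →. BitString) (x : BitString) : ℕ :=
  condK U x []

/-- The encoding `1^ℓ(x) 0 x y` of the pair `(x, y)` as a string. -/
def pairString (x y : BitString) : BitString :=
  List.replicate x.length true ++ false :: (x ++ y)

/-- The complexity distance `d_K` with additive constant `c`. -/
noncomputable def complexityDist (U : BitString → BitString →. BitString) (c : ℝ)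
    (x y : BitString) : ℝ :=
  if x = y then 0 else max (condK U x y : ℝ) (condK U y x : ℝ) + c

/-! ### Scale-embeddings -/

/-- The family `φ s`, `s = 1, 2, …`, is a string-embedding of `V`: the complexity distance of the
images equals `s` times the distance, up to `C log s + B`, uniformly in the points. -/
def IsStringEmbedding (U : BitString → BitString →. BitString) (c : ℝ)
    {V : Type*} [MetricSpace V] (φ : ℕ → V → BitString) : Prop :=
  ∃ C B : ℝ, ∀ s : ℕ, 1 ≤ s → ∀ v w : V,
    |complexityDist U c (φ s v) (φ s w) - s * dist v w| ≤ C * Real.logb 2 s + B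

/-- The map `φ` is a sequence-embedding of `V` with length function `f`: `f` is increasing in `s`,
grows at most polynomially in `s`, and truncating `φ v` after `f s v` bits gives a
string-embedding. -/
structure IsSequenceEmbeddingWith (U : BitString → BitString →. BitString) (c : ℝ)
    {V : Type*} [MetricSpace V] (φ : V → BitSeq) (f : ℕ → V → ℕ) : Prop where
  monotone : ∀ v : V, Monotone fun s => f s v
  polynomial : ∃ A k : ℕ, ∀ s : ℕ, 1 ≤ s → ∀ v : V, f s v ≤ A * s ^ k
  embedding : IsStringEmbedding U c fun s v => seqPrefix (φ v) (f s v)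

/-- The map `φ` is a sequence-embedding of `V`, for a suitable length function. -/
def IsSequenceEmbedding (U : BitString → BitString →. BitString) (c : ℝ)
    {V : Type*} [MetricSpace V] (φ : V → BitSeq) : Prop :=
  ∃ f : ℕ → V → ℕ, IsSequenceEmbeddingWith U c φ f

/-! ### Random and independent sequences -/

/-- A `K`-random sequence: its prefixes are incompressible up to an additive constant. -/
def IsKRandom (U : BitString → BitString →. BitString) (x : BitSeq) : Prop :=
  ∃ k : ℕ, ∀ n : ℕ, n ≤ prefixK U (seqPrefix x n) + k

/-- `K`-independent sequences: the complexity of a pair of prefixes is the sum of the complexities,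
up to a logarithmic term. -/
def AreKIndependent (U : BitString → BitString →. BitString) (y z : BitSeq) : Prop :=
  ∃ C B : ℝ, ∀ n : ℕ, 1 ≤ n →
    |(prefixK U (pairString (seqPrefix y n) (seqPrefix z n)) : ℝ)
      - (prefixK U (seqPrefix y n) + prefixK U (seqPrefix z n))| ≤ C * Real.logb 2 n + B

/-! ### Computable reals with bounded partial quotients -/

/-- A computable real number: dyadic approximations of any precision can be computed. -/
def IsComputableReal (γ : ℝ) : Prop :=
  ∃ num : ℕ → ℤ, Computable num ∧ ∀ n : ℕ, |γ - num n / 2 ^ n| ≤ 1 / 2 ^ n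

/-- The partial quotients of the continued fraction expansion of `γ` are bounded. -/
def HasBoundedPartialQuotients (γ : ℝ) : Prop :=
  ∃ A : ℝ, ∀ (n : ℕ) (q : ℝ), (GenContFract.of γ).partDens.get? n = some q → q ≤ A

/-! ### The explicit embeddings of an interval -/

/-- For `r` in `[0,1]`, the string `y_{<t} z_{t:s}` of length `s`, where `t = ⌈r s⌉`. -/
noncomputable def unitString (y z : BitSeq) (s : ℕ) (r : ℝ) : BitString :=
  (List.range s).map fun i : ℕ => if (i : ℤ) + 1 < ⌈r * s⌉ then y i else z i

/-- For `r` in `[0,1]`, the sequence whose bit number `i = 1, 2, …` is that of `z` if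
`i γ mod 1 ≤ r`, and that of `y` otherwise. -/
noncomputable def unitSequence (y z : BitSeq) (γ : ℝ) (r : ℝ) : BitSeq :=
  fun i => if Int.fract (((i : ℝ) + 1) * γ) ≤ r then z i else y i

/-- The integer `⌈b⌉ - ⌊a⌋`. -/
noncomputable def integerWidth (a b : ℝ) : ℕ :=
  (⌈b⌉ - ⌊a⌋).toNat

/-- The affine map `r ↦ (r - ⌊a⌋) / (⌈b⌉ - ⌊a⌋)`, taking `[a,b]` into `[0,1]`. -/
noncomputable def unitCoord (a b r : ℝ) : ℝ :=
  (r - ⌊a⌋) / (⌈b⌉ - ⌊a⌋)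

/-!
The lower bound on complexities needed for both embeddings comes from a single fact: if `y` and `z`
are random and independent, then `K(y_{1:n}, z_{1:n}) ≥ 2 n - O(log n)`
(`two_mul_le_prefixK_pairString`). Both families of strings are mixtures of `y` and `z`: a
computable mask `m e`, whose index `e ≤ s` costs `O(log s)` bits, tells at which of the `s` positions
the bit of `z` is used. Given one mixture, another one is described by its bits at the
positions where the masks differ (`exists_condK_mixString_le`). Conversely two mixtures reveal both
sequences where the masks differ and one of them elsewhere, so that a description of one mixture given
the other, the second mixture itself, and the missing bits determine `y_{1:s}` and `z_{1:s}`;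
since those have complexity `2 s - O(log s)`, the first description cannot be shorter than the number
of differing positions (`exists_maskDist_le_condK`). Hence `d_K` is the Hamming distance of the masks
up to a logarithmic term, and it remains to count positions. All programs are built with
`exists_program_of_computable`, which prepends a self-delimiting header and data to a program of `U`.

For the strings `y_{<t} z_{t:s}` counting is immediate. For the sequences defined by a rotation by
`γ`, bounded partial quotients imply that `γ` is badly approximable: a quadratic form is invariant
under the continued fraction algorithm (`add_le_mul_abs_mul_fract_sub`). Then Dirichlet's theorem
yields good approximations `p/q` with `q` in every interval of bounded ratio, a block of `q`
consecutive multiples is equidistributed up to `O(1)` (`count_fract_le_of_approx`), and cutting a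
range into such blocks, with a remainder of at most half the length, gives a discrepancy of
`O(log n)` (`abs_count_fract_sub_le`). The masks are computable, because the order of the
multiples of `γ` modulo one can be read off a dyadic approximation of known precision
(`rotationMask_computable`), and an incomputable threshold may be replaced by one of the multiples
(`exists_rotationMask_eq`).

Random independent sequences are obtained by tossing coins: by Kraft's inequality the probability that
some prefix is compressible by two bits is at most `1/4`, for `y`, for `z`, and for the
pair (`coinMeasure_compressible_le`).
-/

/-! ### Programs with a self-delimiting header -/

/-- The number with the binary digits `l`, least significant digit first. -/
def bitsValue (l : BitString) : ℕ :=
  l.foldr (fun b n => Nat.bit b n) 0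

theorem bitsValue_bits (n : ℕ) : bitsValue n.bits = n := by
  induction n using Nat.binaryRec' with
  | zero => simp [bitsValue]
  | bit b n h ih =>
    rw [Nat.bits_append_bit _ _ h]
    exact congrArg (Nat.bit b) ih

theorem length_bits (n : ℕ) : n.bits.length = n.size := by
  exact Nat.size_eq_bits_len n

theorem bitsValue_primrec : Primrec bitsValue := by
  have hbit : Primrec₂ fun (_ : BitString) (q : Bool × ℕ) => Nat.bit q.1 q.2 := by
    refine Primrec.of_eq (f := fun r : BitString × (Bool × ℕ) =>
      cond r.2.1 (2 * r.2.2 + 1) (2 * r.2.2)) ?_ ?_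
    · exact Primrec.cond (Primrec.fst.comp Primrec.snd)
        (Primrec.succ.comp (Primrec.nat_mul.comp (Primrec.const 2) (Primrec.snd.comp Primrec.snd)))
        (Primrec.nat_mul.comp (Primrec.const 2) (Primrec.snd.comp Primrec.snd))
    · rintro ⟨_, b, n⟩
      cases b <;> simp [Nat.bit]
  exact Primrec.list_foldr Primrec.id (Primrec.const 0) hbit

/-- The prefix-free code `1^k 0 v` of a number, where `v` are its `k` binary digits. -/
def header (n : ℕ) : BitString :=
  List.replicate n.size true ++ false :: n.bits

theorem length_header (n : ℕ) : (header n).length = 2 * n.size + 1 := by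
  simp [header, length_bits]; omega

/-- The number whose code `header` is at the beginning of a string. -/
def headerValue (p : BitString) : ℕ :=
  bitsValue ((p.drop (p.idxOf false + 1)).take (p.idxOf false))

/-- Number of bits taken by the header and by the data string whose length it announces. -/
def bodyStart (p : BitString) : ℕ :=
  2 * p.idxOf false + 1 + (headerValue p).unpair.1

/-- The data string that follows the header. -/
def dataString (p : BitString) : BitString :=
  (p.drop (2 * p.idxOf false + 1)).take (headerValue p).unpair.1

theorem headerValue_primrec : Primrec headerValue := by
  have h := Primrec.list_idxOf.comp (Primrec.const false) (Primrec.id (α := BitString))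
  exact bitsValue_primrec.comp
    (Primrec.list_take.comp h (Primrec.list_drop.comp (Primrec.succ.comp h) Primrec.id))

theorem bodyStart_primrec : Primrec bodyStart := by
  have h := Primrec.list_idxOf.comp (Primrec.const false) (Primrec.id (α := BitString))
  exact Primrec.nat_add.comp (Primrec.succ.comp (Primrec.nat_mul.comp (Primrec.const 2) h))
    (Primrec.fst.comp (Primrec.unpair.comp headerValue_primrec))

theorem dataString_primrec : Primrec dataString := by
  have h := Primrec.list_idxOf.comp (Primrec.const false) (Primrec.id (α := BitString))
  exact Primrec.list_take.comp (Primrec.fst.comp (Primrec.unpair.comp headerValue_primrec))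
    (Primrec.list_drop.comp (Primrec.succ.comp (Primrec.nat_mul.comp (Primrec.const 2) h))
      Primrec.id)

theorem idxOf_header_append (n : ℕ) (r : BitString) : (header n ++ r).idxOf false = n.size := by
  simp only [header, List.append_assoc, List.cons_append]
  rw [List.idxOf_append_of_notMem (by simp)]
  simp

theorem headerValue_header_append (n : ℕ) (r : BitString) : headerValue (header n ++ r) = n := by
  have h : (header n ++ r).drop (n.size + 1) = n.bits ++ r := by
    rw [show header n ++ r = (List.replicate n.size true ++ [false]) ++ (n.bits ++ r) by
      simp [header]]
    exact List.drop_left' (by simp)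
  rw [headerValue, idxOf_header_append, h, List.take_left' (length_bits n), bitsValue_bits]

/-- A sufficiently long program is parsed in the same way after an extension. -/
theorem parse_append {p : BitString} (hp : bodyStart p ≤ p.length) (r : BitString) :
    headerValue (p ++ r) = headerValue p ∧ bodyStart (p ++ r) = bodyStart p ∧
      dataString (p ++ r) = dataString p := by
  have hlt : 2 * p.idxOf false + 1 ≤ p.length := (Nat.le_add_right _ _).trans hp
  have hi : (p ++ r).idxOf false = p.idxOf false :=
    List.idxOf_append_of_mem (List.idxOf_lt_length_iff.1 (by omega))
  have hv : headerValue (p ++ r) = headerValue p := by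
    rw [headerValue, hi, List.drop_append_of_le_length (by omega),
      List.take_append_of_le_length (by rw [List.length_drop]; omega), headerValue]
  refine ⟨hv, by rw [bodyStart, hi, hv, bodyStart], ?_⟩
  unfold bodyStart at hp
  rw [dataString, hi, hv, List.drop_append_of_le_length hlt,
    List.take_append_of_le_length (by rw [List.length_drop]; omega), dataString]

/-- The arguments of the decoder: side information, announced number and data string. -/
abbrev DecoderInput : Type := BitString × ℕ × BitString

/-- The arguments that a program `p` passes to the decoder if the side information is `y`. -/
def decoderInput (p y : BitString) : DecoderInput :=
  (y, (headerValue p).unpair.2, dataString p)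

theorem decoderInput_primrec : Primrec₂ decoderInput :=
  Primrec.pair Primrec.snd
    (Primrec.pair (Primrec.snd.comp (Primrec.unpair.comp (headerValue_primrec.comp Primrec.fst)))
      (dataString_primrec.comp Primrec.fst))

/-- The machine which reads a header, a data string and a program `q` of `U`, runs `q` with a side
information computed by `h`, and applies `F` to the result. -/
def headerMachine (U : BitString → BitString →. BitString) (h : DecoderInput → BitString)
    (F : DecoderInput → BitString → BitString) (p y : BitString) : Part BitString :=
  cond (decide (bodyStart p ≤ p.length))
    ((U (p.drop (bodyStart p)) (h (decoderInput p y))).map (F (decoderInput p y))) Part.none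

/-- The header machine is prefix-free: two programs one of which extends the other one are parsed
alike, so that their final parts are programs of `U` for the same side information. -/
theorem headerMachine_isPrefixMachine {U : BitString → BitString →. BitString}
    (hU : IsPrefixMachine U) {h : DecoderInput → BitString} (hh : Computable h)
    {F : DecoderInput → BitString → BitString} (hF : Computable₂ F) :
    IsPrefixMachine (headerMachine U h F) where
  partrec := by
    have hd : Computable fun a : BitString × BitString => decoderInput a.1 a.2 :=
      decoderInput_primrec.to_comp
    refine Partrec.cond ?_ ?_ Partrec.none
    · exact ((Primrec.nat_le.comp (bodyStart_primrec.comp Primrec.fst)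
        (Primrec.list_length.comp Primrec.fst)).decide).to_comp
    · refine Partrec.map (Partrec₂.comp hU.partrec ?_ (hh.comp hd)) ?_
      · exact (Primrec.list_drop.comp (bodyStart_primrec.comp Primrec.fst) Primrec.fst).to_comp
      · exact hF.comp (hd.comp Computable.fst) Computable.snd
  prefixFree := by
    intro y p q hp hq hpq
    obtain ⟨r, rfl⟩ := hpq
    have hb : bodyStart p ≤ p.length := by
      by_contra hb
      simp [headerMachine, hb] at hp
    obtain ⟨hv, hs, hdata⟩ := parse_append hb r
    have hi : decoderInput (p ++ r) y = decoderInput p y := by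
      rw [decoderInput, hv, hdata, decoderInput]
    have hb' : bodyStart p ≤ (p ++ r).length := by rw [List.length_append]; omega
    simp only [headerMachine, hs, hi, hb, hb', decide_true, cond_true,
      List.drop_append_of_le_length hb] at hp hq
    have := hU.prefixFree _ _ _ hp hq (List.prefix_append _ _)
    simpa using this

/-- The simulation lemma behind all upper bounds on complexities: from a program of `U` together
with a number `e` and a data string `w` one obtains a program which is longer by the length of `w`
and by a logarithmic number of bits. -/
theorem exists_program_of_computable {U : BitString → BitString →. BitString}
    (hU : IsOptimalPrefixMachine U) {h : DecoderInput → BitString} (hh : Computable h)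
    {F : DecoderInput → BitString → BitString} (hF : Computable₂ F) :
    ∃ c : ℕ, ∀ (y : BitString) (e : ℕ) (w x q : BitString), x ∈ U q (h (y, e, w)) →
      ∃ p : BitString, p.length ≤ q.length + w.length + 2 * (Nat.pair w.length e).size + c ∧
        F (y, e, w) x ∈ U p y := by
  obtain ⟨c, hc⟩ := hU.optimal _ (headerMachine_isPrefixMachine hU.toIsPrefixMachine hh hF)
  refine ⟨c + 1, fun y e w x q hx => ?_⟩
  set n := Nat.pair w.length e with hn
  have hv : headerValue (header n ++ (w ++ q)) = n := headerValue_header_append _ _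
  have hs : bodyStart (header n ++ (w ++ q)) = 2 * n.size + 1 + w.length := by
    rw [bodyStart, hv, idxOf_header_append, hn, Nat.unpair_pair]
  have hdata : dataString (header n ++ (w ++ q)) = w := by
    rw [dataString, hv, idxOf_header_append, List.drop_left' (length_header n), hn,
      Nat.unpair_pair, List.take_left' rfl]
  have hi : decoderInput (header n ++ (w ++ q)) y = (y, e, w) := by
    rw [decoderInput, hv, hdata, hn, Nat.unpair_pair]
  have hq : (header n ++ (w ++ q)).drop (2 * n.size + 1 + w.length) = q := by
    rw [← List.append_assoc]
    exact List.drop_left' (by rw [List.length_append, length_header])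
  have hlen : (header n ++ (w ++ q)).length = 2 * n.size + 1 + w.length + q.length := by
    simp only [List.length_append, length_header]; omega
  obtain ⟨p, hp, hpx⟩ := hc (header n ++ (w ++ q)) y (F (y, e, w) x) (by
    rw [headerMachine, hs, hi, hq, hlen]
    simpa using ⟨x, hx, rfl⟩)
  exact ⟨p, by omega, hpx⟩

/-! ### Basic properties of the complexity -/

theorem condK_le {U : BitString → BitString →. BitString} {x y p : BitString} (h : x ∈ U p y) :
    condK U x y ≤ p.length :=
  Nat.sInf_le ⟨p, rfl, h⟩

/-- The empty string has a program of bounded length, for every side information. -/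
theorem exists_program_nil {U : BitString → BitString →. BitString}
    (hU : IsOptimalPrefixMachine U) :
    ∃ c : ℕ, ∀ y : BitString, ∃ p : BitString, p.length ≤ c ∧ [] ∈ U p y := by
  obtain ⟨c, hc⟩ := hU.optimal
    (fun p _ => cond (decide (p.length = 0)) (Part.some []) Part.none)
    { partrec := Partrec.cond
        (Primrec.eq.comp (Primrec.list_length.comp Primrec.fst) (Primrec.const 0)).decide.to_comp
        (Computable.const []) Partrec.none
      prefixFree := by
        intro y p q hp hq _
        rcases p with _ | ⟨a, p⟩
        · rcases q with _ | ⟨b, q⟩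
          · rfl
          · simp at hq
        · simp at hp }
  refine ⟨c, fun y => ?_⟩
  obtain ⟨p, hp, hx⟩ := hc [] y [] (by simp)
  exact ⟨p, by simpa using hp, hx⟩

/-- Every string of the form `F (y, e, w)` has complexity at most the length of the data `w`, up to
logarithmic terms. -/
theorem exists_condK_le_length {U : BitString → BitString →. BitString}
    (hU : IsOptimalPrefixMachine U) {F : DecoderInput → BitString} (hF : Computable F) :
    ∃ c : ℕ, ∀ (y : BitString) (e : ℕ) (w : BitString),
      condK U (F (y, e, w)) y ≤ w.length + 2 * (Nat.pair w.length e).size + c := by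
  obtain ⟨c₀, h₀⟩ := exists_program_nil hU
  obtain ⟨c, hc⟩ := exists_program_of_computable hU (h := fun _ => []) (Computable.const [])
    (F := fun d _ => F d) (hF.comp Computable.fst)
  refine ⟨c + c₀, fun y e w => ?_⟩
  obtain ⟨q, hq, hx⟩ := h₀ []
  obtain ⟨p, hp, hpx⟩ := hc y e w [] q hx
  have := condK_le hpx
  omega

/-- Shortest programs exist. -/
theorem exists_program_condK {U : BitString → BitString →. BitString}
    (hU : IsOptimalPrefixMachine U) (x y : BitString) :
    ∃ p : BitString, p.length = condK U x y ∧ x ∈ U p y := by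
  have hne : {n : ℕ | ∃ p : BitString, p.length = n ∧ x ∈ U p y}.Nonempty := by
    obtain ⟨c, hc⟩ := exists_program_of_computable hU (h := fun _ => []) (Computable.const [])
      (F := fun d _ => d.2.2) ((Computable.snd.comp Computable.snd).comp Computable.fst)
    obtain ⟨c₀, h₀⟩ := exists_program_nil hU
    obtain ⟨q, -, hx⟩ := h₀ []
    obtain ⟨p, -, hp⟩ := hc y 0 x [] q hx
    exact ⟨_, p, rfl, hp⟩
  exact Nat.sInf_mem hne

theorem exists_condK_le_condK {U : BitString → BitString →. BitString}
    (hU : IsOptimalPrefixMachine U) {h : DecoderInput → BitString} (hh : Computable h)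
    {F : DecoderInput → BitString → BitString} (hF : Computable₂ F) :
    ∃ c : ℕ, ∀ (y : BitString) (e : ℕ) (w x : BitString),
      condK U (F (y, e, w) x) y ≤
        condK U x (h (y, e, w)) + w.length + 2 * (Nat.pair w.length e).size + c := by
  obtain ⟨c, hc⟩ := exists_program_of_computable hU hh hF
  refine ⟨c, fun y e w x => ?_⟩
  obtain ⟨q, hq, hx⟩ := exists_program_condK hU x (h (y, e, w))
  obtain ⟨p, hp, hpx⟩ := hc y e w x q hx
  have := condK_le hpx
  omega

/-! ### Computability of tables and of counting functions -/

theorem Computable.map_range {α σ : Type*} [Primcodable α] [Primcodable σ] {g : α → ℕ}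
    {f : α → ℕ → σ} (hg : Computable g) (hf : Computable₂ f) :
    Computable fun a => (List.range (g a)).map (f a) := by
  refine (Computable.nat_rec (f := g) (g := fun _ => ([] : List σ))
    (h := fun a q => q.2 ++ [f a q.1]) hg (Computable.const []) ?_).of_eq fun a => ?_
  · exact Computable.list_concat.comp (Computable.snd.comp Computable.snd)
      (hf.comp Computable.fst (Computable.fst.comp Computable.snd))
  · induction g a with
    | zero => rfl
    | succ n ih => rw [List.range_succ, List.map_append, ← ih]; rfl

theorem Computable.nat_count {α : Type*} [Primcodable α] {g : α → ℕ} {f : α → ℕ → Bool}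
    (hg : Computable g) (hf : Computable₂ f) :
    Computable fun a => Nat.count (fun i => f a i = true) (g a) := by
  refine (Computable.nat_rec (f := g) (g := fun _ => (0 : ℕ))
    (h := fun a q => _root_.cond (f a q.1) (q.2 + 1) q.2) hg (Computable.const 0) ?_).of_eq fun a => ?_
  · exact Computable.cond (hf.comp Computable.fst (Computable.fst.comp Computable.snd))
      (Computable.succ.comp (Computable.snd.comp Computable.snd))
      (Computable.snd.comp Computable.snd)
  · induction g a with
    | zero => rfl
    | succ n ih =>
      rw [Nat.count_succ, ← ih]
      cases h : f a n <;> simp [h]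

theorem xor_computable : Computable₂ xor :=
  Primrec.dom_bool₂ _ |>.to_comp

theorem pairString_computable : Computable₂ pairString := by
  have hr : Computable fun a : BitString × BitString => List.replicate a.1.length true := by
    refine (Computable.map_range (g := fun a : BitString × BitString => a.1.length)
      (f := fun _ _ => true) (Computable.list_length.comp Computable.fst)
      (Computable.const true)).of_eq fun a => ?_
    simp
  exact Computable.list_append.comp hr (Computable.list_cons.comp (Computable.const false)
    Computable.list_append)

/-! ### Sizes of numerical parameters -/

theorem size_pair_le (a b : ℕ) : (Nat.pair a b).size ≤ 2 * max a.size b.size := by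
  rw [Nat.size_le]
  have ha : a < 2 ^ max a.size b.size :=
    a.lt_size_self.trans_le (Nat.pow_le_pow_right two_pos (le_max_left _ _))
  have hb : b < 2 ^ max a.size b.size :=
    b.lt_size_self.trans_le (Nat.pow_le_pow_right two_pos (le_max_right _ _))
  calc Nat.pair a b < (max a b + 1) ^ 2 := Nat.pair_lt_max_add_one_sq a b
    _ ≤ (2 ^ max a.size b.size) ^ 2 := Nat.pow_le_pow_left (by omega) 2
    _ = 2 ^ (2 * max a.size b.size) := by rw [← pow_mul, mul_comm]

theorem size_two_mul_le {n k : ℕ} (h : k ≤ 2 * n) : k.size ≤ n.size + 1 := by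
  rw [Nat.size_le, pow_succ]
  have := n.lt_size_self
  omega

/-- The number that announces a data string of length `k` and the parameters `s`, `e`, `e'` has
`O(log s)` digits. -/
theorem size_code_le {s e e' k : ℕ} (he : e ≤ s) (he' : e' ≤ s) (hk : k ≤ 2 * s) :
    (Nat.pair k (Nat.pair s (Nat.pair e e'))).size ≤ 8 * (s.size + 1) := by
  have h1 := size_pair_le e e'
  have h2 := size_pair_le s (Nat.pair e e')
  have h3 := size_pair_le k (Nat.pair s (Nat.pair e e'))
  have h4 := Nat.size_le_size he
  have h5 := Nat.size_le_size he'
  have h6 := size_two_mul_le hk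
  omega

/-! ### Mixtures of two sequences -/

/-- The string of length `s` whose bits are those of `z` at the positions selected by the mask
`m e`, and those of `y` elsewhere. -/
def mixString (m : ℕ → ℕ → Bool) (y z : BitSeq) (s e : ℕ) : BitString :=
  (List.range s).map fun i => cond (m e i) (z i) (y i)

/-- The number of positions below `s` at which the masks `m e` and `m e'` differ. -/
def maskDist (m : ℕ → ℕ → Bool) (s e e' : ℕ) : ℕ :=
  Nat.count (fun i => xor (m e i) (m e' i) = true) s

theorem maskDist_comm (m : ℕ → ℕ → Bool) (s e e' : ℕ) : maskDist m s e e' = maskDist m s e' e := by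
  simp only [maskDist, Bool.xor_comm]

theorem getD_map_range (f : ℕ → Bool) {s i : ℕ} (hi : i < s) :
    ((List.range s).map f).getD i false = f i := by
  simp [List.getD_eq_getElem?_getD, hi]

/-- The bits of `x` at the positions satisfying `p` can be stored consecutively, the bit at
position `i` having index `Nat.count p i`. -/
theorem exists_packed (p : ℕ → Prop) [DecidablePred p] (x : ℕ → Bool) (s : ℕ) :
    ∃ w : BitString, w.length = Nat.count p s ∧
      ∀ i < s, p i → w.getD (Nat.count p i) false = x i := by
  induction s with
  | zero => exact ⟨[], by simp⟩
  | succ s ih =>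
    obtain ⟨w, hw, hx⟩ := ih
    by_cases hp : p s
    · refine ⟨w ++ [x s], by simp [hw, Nat.count_succ, hp], fun i hi hpi => ?_⟩
      rcases Nat.lt_succ_iff_lt_or_eq.1 hi with hi | rfl
      · rw [List.getD_append _ _ _ _ (by rw [hw]; exact Nat.count_strict_mono hpi hi), hx i hi hpi]
      · rw [List.getD_append_right _ _ _ _ hw.le, hw]
        simp
    · refine ⟨w, by simp [hw, Nat.count_succ, hp], fun i hi hpi => ?_⟩
      rcases Nat.lt_succ_iff_lt_or_eq.1 hi with hi | rfl
      · exact hx i hi hpi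
      · exact absurd hpi hp

/-- The parameter `s` encoded in the number of a decoder input. -/
def codeLength (d : DecoderInput) : ℕ := d.2.1.unpair.1
/-- The index of the first mask encoded in the number of a decoder input. -/
def codeFst (d : DecoderInput) : ℕ := d.2.1.unpair.2.unpair.1
/-- The index of the second mask encoded in the number of a decoder input. -/
def codeSnd (d : DecoderInput) : ℕ := d.2.1.unpair.2.unpair.2

theorem codeLength_computable : Computable codeLength :=
  (Primrec.fst.comp (Primrec.unpair.comp (Primrec.fst.comp Primrec.snd))).to_comp

theorem codeFst_computable : Computable codeFst :=
  (Primrec.fst.comp (Primrec.unpair.comp (Primrec.snd.comp (Primrec.unpair.comp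
    (Primrec.fst.comp Primrec.snd))))).to_comp

theorem codeSnd_computable : Computable codeSnd :=
  (Primrec.snd.comp (Primrec.unpair.comp (Primrec.snd.comp (Primrec.unpair.comp
    (Primrec.fst.comp Primrec.snd))))).to_comp

theorem getD_computable : Computable₂ fun (l : BitString) (n : ℕ) => l.getD n false :=
  (Primrec.list_getD false).to_comp

/-- Replacing the bits at which two masks differ turns one mixture into another one. -/
theorem exists_condK_mixString_le {U : BitString → BitString →. BitString}
    (hU : IsOptimalPrefixMachine U) {m : ℕ → ℕ → Bool} (hm : Computable₂ m) (y z : BitSeq) :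
    ∃ D : ℕ, ∀ s e e' : ℕ, e ≤ s → e' ≤ s →
      condK U (mixString m y z s e) (mixString m y z s e') ≤
        maskDist m s e e' + D * (s.size + 1) := by
  have hm1 : Computable₂ fun (d : DecoderInput) (i : ℕ) => m (codeFst d) i :=
    hm.comp (codeFst_computable.comp Computable.fst) Computable.snd
  have hm2 : Computable₂ fun (d : DecoderInput) (i : ℕ) => m (codeSnd d) i :=
    hm.comp (codeSnd_computable.comp Computable.fst) Computable.snd
  have hx : Computable₂ fun (d : DecoderInput) (i : ℕ) => xor (m (codeFst d) i) (m (codeSnd d) i) :=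
    xor_computable.comp hm1 hm2
  have hF : Computable fun d : DecoderInput => (List.range (codeLength d)).map fun i =>
      cond (xor (m (codeFst d) i) (m (codeSnd d) i))
        (d.2.2.getD (Nat.count (fun j => xor (m (codeFst d) j) (m (codeSnd d) j) = true) i) false)
        (d.1.getD i false) := by
    refine Computable.map_range codeLength_computable (Computable.cond hx ?_ ?_)
    · exact getD_computable.comp
        ((Computable.snd.comp Computable.snd).comp Computable.fst)
        (Computable.nat_count (α := DecoderInput × ℕ) Computable.snd
          (hx.comp (Computable.fst.comp Computable.fst) Computable.snd))
    · exact getD_computable.comp (Computable.fst.comp Computable.fst) Computable.snd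
  obtain ⟨c, hc⟩ := exists_condK_le_length hU hF
  refine ⟨16 + c, fun s e e' he he' => ?_⟩
  obtain ⟨w, hw, hwx⟩ := exists_packed (fun i => xor (m e i) (m e' i) = true)
    (fun i => cond (m e i) (z i) (y i)) s
  have h := hc (mixString m y z s e') (Nat.pair s (Nat.pair e e')) w
  have hsize := size_code_le he he' (k := w.length) (by
    have := Nat.count_le (p := fun i => xor (m e i) (m e' i) = true) (n := s)
    omega)
  simp only [codeLength, codeFst, codeSnd, Nat.unpair_pair] at h
  have heq : ((List.range s).map fun i => cond (xor (m e i) (m e' i))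
      (w.getD (Nat.count (fun j => xor (m e j) (m e' j) = true) i) false)
      ((mixString m y z s e').getD i false)) = mixString m y z s e := by
    refine List.map_congr_left fun i hi => ?_
    have hi : i < s := List.mem_range.1 hi
    cases hxor : xor (m e i) (m e' i)
    · rw [mixString, getD_map_range _ hi]
      cases h1 : m e i <;> cases h2 : m e' i <;> simp_all
    · simpa using hwx i hi hxor
  rw [heq] at h
  have : maskDist m s e e' = w.length := hw.symm
  nlinarith

/-- Two mixtures, together with the bits at which their masks agree and which both of them omit,
determine prefixes of both sequences. If these have the largest possible joint complexity, the
complexity of one mixture given the other one is at least the number of positions at which the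
masks differ. -/
theorem exists_maskDist_le_condK {U : BitString → BitString →. BitString}
    (hU : IsOptimalPrefixMachine U) {m : ℕ → ℕ → Bool} (hm : Computable₂ m) {y z : BitSeq}
    {D₀ : ℕ} (hyz : ∀ n : ℕ, 2 * n ≤
      prefixK U (pairString (seqPrefix y n) (seqPrefix z n)) + D₀ * (n.size + 1)) :
    ∃ D : ℕ, ∀ s e e' : ℕ, e ≤ s → e' ≤ s →
      maskDist m s e e' ≤
        condK U (mixString m y z s e) (mixString m y z s e') + D * (s.size + 1) := by
  have hm1 : Computable₂ fun (d : DecoderInput × BitString) (i : ℕ) => m (codeFst d.1) i :=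
    hm.comp ((codeFst_computable.comp Computable.fst).comp Computable.fst) Computable.snd
  have hm2 : Computable₂ fun (d : DecoderInput × BitString) (i : ℕ) => m (codeSnd d.1) i :=
    hm.comp ((codeSnd_computable.comp Computable.fst).comp Computable.fst) Computable.snd
  have hx : Computable₂ fun (d : DecoderInput × BitString) (i : ℕ) =>
      !xor (m (codeFst d.1) i) (m (codeSnd d.1) i) :=
    Primrec.not.to_comp.comp (xor_computable.comp hm1 hm2)
  have hs : Computable fun d : DecoderInput × BitString => codeLength d.1 :=
    codeLength_computable.comp Computable.fst
  have hw : Computable fun d : DecoderInput × BitString => d.1.2.2 :=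
    (Computable.snd.comp Computable.snd).comp Computable.fst
  have hx2 : Computable₂ fun (d : DecoderInput × BitString) (i : ℕ) => d.2.getD i false :=
    getD_computable.comp (Computable.snd.comp Computable.fst) Computable.snd
  have hw2 : Computable₂ fun (d : DecoderInput × BitString) (i : ℕ) => d.1.2.2.getD i false :=
    getD_computable.comp (hw.comp Computable.fst) Computable.snd
  have hr : Computable₂ fun (d : DecoderInput × BitString) (i : ℕ) =>
      d.1.2.2.getD (codeLength d.1 +
        Nat.count (fun j => (!xor (m (codeFst d.1) j) (m (codeSnd d.1) j)) = true) i) false :=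
    getD_computable.comp (hw.comp Computable.fst)
      (Primrec.nat_add.to_comp.comp (hs.comp Computable.fst)
        (Computable.nat_count (α := (DecoderInput × BitString) × ℕ) Computable.snd
          (hx.comp (Computable.fst.comp Computable.fst) Computable.snd)))
  have hF : Computable₂ fun (d : DecoderInput) (x : BitString) =>
      pairString
        ((List.range (codeLength d)).map fun i => cond (m (codeFst d) i)
          (cond (m (codeSnd d) i)
            (d.2.2.getD (codeLength d +
              Nat.count (fun j => (!xor (m (codeFst d) j) (m (codeSnd d) j)) = true) i) false)
            (d.2.2.getD i false))
          (x.getD i false))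
        ((List.range (codeLength d)).map fun i => cond (m (codeFst d) i)
          (x.getD i false)
          (cond (m (codeSnd d) i)
            (d.2.2.getD i false)
            (d.2.2.getD (codeLength d +
              Nat.count (fun j => (!xor (m (codeFst d) j) (m (codeSnd d) j)) = true) i) false))) :=
    pairString_computable.comp
      (Computable.map_range hs (Computable.cond hm1 (Computable.cond hm2 hr hw2) hx2))
      (Computable.map_range hs (Computable.cond hm1 hx2 (Computable.cond hm2 hw2 hr)))
  have hh : Computable fun d : DecoderInput => d.2.2.take (codeLength d) :=
    Primrec.list_take.to_comp.comp codeLength_computable (Computable.snd.comp Computable.snd)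
  obtain ⟨c, hc⟩ := exists_condK_le_condK hU hh hF
  refine ⟨16 + c + D₀, fun s e e' he he' => ?_⟩
  obtain ⟨w, hw, hwx⟩ := exists_packed (fun i => (!xor (m e i) (m e' i)) = true)
    (fun i => cond (m e i) (y i) (z i)) s
  have hcount : w.length + maskDist m s e e' = s := by
    rw [hw, maskDist, Nat.count_eq_card_filter_range, Nat.count_eq_card_filter_range]
    have := Finset.card_filter_add_card_filter_not (s := Finset.range s)
      (fun i => xor (m e i) (m e' i) = true)
    simp only [Finset.card_range, Bool.not_eq_true] at this
    simp only [Bool.not_eq_true']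
    omega
  set x := mixString m y z s e
  set x' := mixString m y z s e' with hx'
  have hlen : x'.length = s := by simp [hx', mixString]
  have hsize := size_code_le he he' (k := (x' ++ w).length) (by
    rw [List.length_append]; omega)
  have h := hc [] (Nat.pair s (Nat.pair e e')) (x' ++ w) x
  simp only [codeLength, codeFst, codeSnd, Nat.unpair_pair, List.take_left' hlen] at h
  have hxi : ∀ i < s, x.getD i false = cond (m e i) (z i) (y i) := fun i hi => getD_map_range _ hi
  have hxi' : ∀ i < s, (x' ++ w).getD i false = cond (m e' i) (z i) (y i) := fun i hi => by
    rw [List.getD_append _ _ _ _ (by omega), hx', mixString, getD_map_range _ hi]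
  have hwi : ∀ i < s, m e i = m e' i →
      (x' ++ w).getD (s + Nat.count (fun j => (!xor (m e j) (m e' j)) = true) i) false =
        cond (m e i) (y i) (z i) := fun i hi hi' => by
    rw [List.getD_append_right _ _ _ _ (by omega), hlen, Nat.add_sub_cancel_left]
    exact hwx i hi (by simp [hi'])
  have hy : ((List.range s).map fun i => cond (m e i)
      (cond (m e' i)
        ((x' ++ w).getD (s + Nat.count (fun j => (!xor (m e j) (m e' j)) = true) i) false)
        ((x' ++ w).getD i false)) (x.getD i false)) = seqPrefix y s := by
    refine List.map_congr_left fun i hi => ?_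
    have hi : i < s := List.mem_range.1 hi
    have h3 := hwi i hi
    rw [hxi i hi, hxi' i hi]
    cases h1 : m e i <;> cases h2 : m e' i <;> simp_all
  have hz : ((List.range s).map fun i => cond (m e i) (x.getD i false)
      (cond (m e' i) ((x' ++ w).getD i false)
        ((x' ++ w).getD (s + Nat.count (fun j => (!xor (m e j) (m e' j)) = true) i) false))) =
        seqPrefix z s := by
    refine List.map_congr_left fun i hi => ?_
    have hi : i < s := List.mem_range.1 hi
    have h3 := hwi i hi
    rw [hxi i hi, hxi' i hi]
    cases h1 : m e i <;> cases h2 : m e' i <;> simp_all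
  rw [hy, hz] at h
  have h0 := hyz s
  rw [prefixK] at h0
  rw [List.length_append, hlen] at h hsize
  nlinarith

/-- The complexity distance of two mixtures of sequences whose prefixes have the largest possible
joint complexity is the number of positions at which the masks differ, up to a logarithmic term. -/
theorem exists_abs_complexityDist_sub_maskDist_le {U : BitString → BitString →. BitString}
    (hU : IsOptimalPrefixMachine U) {c : ℝ} (hc : 0 ≤ c) {m : ℕ → ℕ → Bool} (hm : Computable₂ m)
    {y z : BitSeq} {D₀ : ℕ} (hyz : ∀ n : ℕ, 2 * n ≤
      prefixK U (pairString (seqPrefix y n) (seqPrefix z n)) + D₀ * (n.size + 1)) :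
    ∃ D : ℝ, 0 ≤ D ∧ ∀ s e e' : ℕ, e ≤ s → e' ≤ s →
      |complexityDist U c (mixString m y z s e) (mixString m y z s e') - maskDist m s e e'| ≤
        D * (s.size + 1) := by
  obtain ⟨D₁, h₁⟩ := exists_condK_mixString_le hU hm y z
  obtain ⟨D₂, h₂⟩ := exists_maskDist_le_condK hU hm hyz
  refine ⟨D₁ + D₂ + c, by positivity, fun s e e' he he' => ?_⟩
  have hu : (condK U (mixString m y z s e) (mixString m y z s e') : ℝ) ≤
      maskDist m s e e' + D₁ * (s.size + 1) := mod_cast h₁ s e e' he he'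
  have hu' : (condK U (mixString m y z s e') (mixString m y z s e) : ℝ) ≤
      maskDist m s e e' + D₁ * (s.size + 1) := by
    rw [maskDist_comm]; exact mod_cast h₁ s e' e he' he
  have hl : (maskDist m s e e' : ℝ) ≤
      condK U (mixString m y z s e) (mixString m y z s e') + D₂ * (s.size + 1) :=
    mod_cast h₂ s e e' he he'
  have hself : (condK U (mixString m y z s e) (mixString m y z s e) : ℝ) ≤ D₁ * (s.size + 1) := by
    have := h₁ s e e he he
    simp only [maskDist, Bool.xor_self, Bool.false_eq_true, Nat.count_false, zero_add] at this
    exact mod_cast this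
  have hn : (0 : ℝ) ≤ s.size := Nat.cast_nonneg _
  have hD₁ : (0 : ℝ) ≤ D₁ * (s.size + 1) := by positivity
  have hD₂ : (0 : ℝ) ≤ D₂ * (s.size + 1) := by positivity
  have hcs : c ≤ c * (s.size + 1) := le_mul_of_one_le_right hc (by linarith)
  have hd : (0 : ℝ) ≤ maskDist m s e e' := Nat.cast_nonneg _
  rw [complexityDist, abs_le]
  split_ifs with h
  · rw [← h] at hl
    constructor <;> linarith
  · have := le_max_left (condK U (mixString m y z s e) (mixString m y z s e') : ℝ)
      (condK U (mixString m y z s e') (mixString m y z s e))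
    have := max_le hu hu'
    constructor <;> linarith

/-! ### Existence of random independent sequences -/

/-- The distribution of a family of independent fair coin tosses. -/
noncomputable def coinMeasure (ι : Type*) : MeasureTheory.Measure (ι → Bool) :=
  MeasureTheory.Measure.infinitePi fun _ => (PMF.uniformOfFintype Bool).toMeasure

instance (ι : Type*) : MeasureTheory.IsProbabilityMeasure (coinMeasure ι) := by
  unfold coinMeasure; infer_instance

theorem coinMeasure_cylinder {ι : Type*} (I : Finset ι) (b : ι → Bool) :
    coinMeasure ι {x | ∀ i ∈ I, x i = b i} = 2⁻¹ ^ I.card := by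
  have h : {x : ι → Bool | ∀ i ∈ I, x i = b i} = Set.pi I fun i => {b i} := by
    ext x; simp [Set.mem_pi]
  rw [h, coinMeasure, MeasureTheory.Measure.infinitePi_pi _ fun i _ => measurableSet_singleton _]
  simp

theorem seqPrefix_eq_iff {x : BitSeq} {p : BitString} :
    seqPrefix x p.length = p ↔ ∀ i ∈ Finset.range p.length, x i = p.getD i false := by
  constructor
  · intro h i hi
    rw [← h, seqPrefix, getD_map_range x (Finset.mem_range.1 hi)]
  · intro h
    refine List.ext_getElem (by simp [seqPrefix]) fun i h1 h2 => ?_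
    have := h i (Finset.mem_range.2 h2)
    simp [seqPrefix, this, h2]

theorem seqPrefix_prefix {x : BitSeq} {m n : ℕ} (h : m ≤ n) : seqPrefix x m <+: seqPrefix x n := by
  obtain ⟨k, rfl⟩ := Nat.exists_eq_add_of_le h
  exact ⟨_, by rw [seqPrefix, seqPrefix, List.range_add, List.map_append]⟩

/-- Kraft's inequality for the programs of a prefix machine. -/
theorem tsum_inv_two_pow_length_le_one {U : BitString → BitString →. BitString}
    (hU : IsPrefixMachine U) (y : BitString) :
    ∑' p : {p : BitString // (U p y).Dom}, (2⁻¹ : ENNReal) ^ p.1.length ≤ 1 := by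
  have hcyl : ∀ p : BitString, {x : BitSeq | seqPrefix x p.length = p} =
      {x | ∀ i ∈ Finset.range p.length, x i = p.getD i false} := fun p => by
    ext x; exact seqPrefix_eq_iff
  have hmeas : ∀ p : BitString, MeasurableSet {x : BitSeq | seqPrefix x p.length = p} := by
    intro p
    rw [hcyl]
    simp only [Set.ofPred_forall]
    exact Finset.measurableSet_biInter _ fun i _ =>
      measurableSet_eq_fun (measurable_pi_apply i) measurable_const
  calc ∑' p : {p : BitString // (U p y).Dom}, (2⁻¹ : ENNReal) ^ p.1.length
      = ∑' p : {p : BitString // (U p y).Dom},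
          coinMeasure ℕ {x : BitSeq | seqPrefix x p.1.length = p.1} := by
        refine tsum_congr fun p => ?_
        rw [hcyl, coinMeasure_cylinder, Finset.card_range]
    _ ≤ coinMeasure ℕ Set.univ := by
        refine MeasureTheory.tsum_measure_le_measure_univ
          (fun p => (hmeas p.1).nullMeasurableSet) fun p q hpq => ?_
        refine Disjoint.aedisjoint (Set.disjoint_left.2 fun x hp hq => hpq (Subtype.ext ?_))
        simp only [Set.mem_ofPred_eq] at hp hq
        rcases le_total p.1.length q.1.length with h | h
        · exact hU.prefixFree y _ _ p.2 q.2 (hp ▸ hq ▸ by simpa [seqPrefix] using seqPrefix_prefix h)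
        · exact (hU.prefixFree y _ _ q.2 p.2
            (hp ▸ hq ▸ by simpa [seqPrefix] using seqPrefix_prefix h)).symm
    _ = 1 := MeasureTheory.measure_univ

/-- If the string `code ω n` determines `n` and the coin tosses with index in `I n`, then it is
compressible by two bits or more, for some `n`, with probability at most `1 / 4`. -/
theorem coinMeasure_compressible_le {ι : Type*} {U : BitString → BitString →. BitString}
    (hU : IsPrefixMachine U) (code : (ι → Bool) → ℕ → BitString) (I : ℕ → Finset ι)
    (hcode : ∀ ω ω' n n', code ω n = code ω' n' → n = n' ∧ ∀ i ∈ I n, ω i = ω' i) :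
    coinMeasure ι {ω | ∃ n p, code ω n ∈ U p [] ∧ p.length + 2 ≤ (I n).card} ≤ 4⁻¹ := by
  set A : {p : BitString // (U p []).Dom} → Set (ι → Bool) :=
    fun p => {ω | ∃ n, code ω n ∈ U p.1 [] ∧ p.1.length + 2 ≤ (I n).card} with hA
  have hsub : {ω | ∃ n p, code ω n ∈ U p [] ∧ p.length + 2 ≤ (I n).card} ⊆ ⋃ p, A p := by
    rintro ω ⟨n, p, hp, hn⟩
    exact Set.mem_iUnion.2 ⟨⟨p, Part.dom_iff_mem.2 ⟨_, hp⟩⟩, n, hp, hn⟩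
  have hAp : ∀ p, coinMeasure ι (A p) ≤ 2⁻¹ ^ p.1.length * 4⁻¹ := by
    intro p
    rcases (A p).eq_empty_or_nonempty with h | ⟨ω₀, n₀, h₀, hn₀⟩
    · simp [h]
    · have hsub : A p ⊆ {ω | ∀ i ∈ I n₀, ω i = ω₀ i} := by
        rintro ω ⟨n, h, -⟩ i hi
        exact ((hcode _ _ _ _ (Part.mem_unique h₀ h)).2 i hi).symm
      calc coinMeasure ι (A p) ≤ 2⁻¹ ^ (I n₀).card :=
            (MeasureTheory.measure_mono hsub).trans (coinMeasure_cylinder _ _).le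
        _ ≤ 2⁻¹ ^ (p.1.length + 2) := pow_le_pow_right_of_le_one' (by simp) hn₀
        _ = 2⁻¹ ^ p.1.length * 4⁻¹ := by
            rw [pow_add, ← ENNReal.inv_pow (n := 2)]; norm_num
  calc _ ≤ coinMeasure ι (⋃ p, A p) := MeasureTheory.measure_mono hsub
    _ ≤ ∑' p, coinMeasure ι (A p) := MeasureTheory.measure_iUnion_le _
    _ ≤ ∑' p : {p : BitString // (U p []).Dom}, (2⁻¹ : ENNReal) ^ p.1.length * 4⁻¹ :=
        ENNReal.tsum_le_tsum hAp
    _ ≤ 1 * 4⁻¹ := by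
        rw [ENNReal.tsum_mul_right]
        gcongr
        exact tsum_inv_two_pow_length_le_one hU []
    _ = 4⁻¹ := one_mul _

theorem exists_notMem_of_measure_le {Ω : Type*} [MeasurableSpace Ω] {μ : MeasureTheory.Measure Ω}
    [MeasureTheory.IsProbabilityMeasure μ] {A B C : Set Ω} (hA : μ A ≤ 4⁻¹) (hB : μ B ≤ 4⁻¹)
    (hC : μ C ≤ 4⁻¹) : ∃ ω, ω ∉ A ∧ ω ∉ B ∧ ω ∉ C := by
  by_contra! hall
  have h : μ ((A ∪ B) ∪ C) ≤ 4⁻¹ + 4⁻¹ + 4⁻¹ := (MeasureTheory.measure_union_le _ _).trans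
    (add_le_add ((MeasureTheory.measure_union_le _ _).trans (add_le_add hA hB)) hC)
  rw [Set.eq_univ_of_forall (s := (A ∪ B) ∪ C) fun ω => by
    by_contra hω
    simp only [Set.mem_union, not_or] at hω
    exact hω.2 (hall ω hω.1.1 hω.1.2), MeasureTheory.measure_univ] at h
  have h4 : (4⁻¹ : ENNReal) = ENNReal.ofReal 4⁻¹ := by
    rw [ENNReal.ofReal_inv_of_pos (by norm_num)]; simp
  rw [h4, ← ENNReal.ofReal_add (by norm_num) (by norm_num),
    ← ENNReal.ofReal_add (by norm_num) (by norm_num), ENNReal.one_le_ofReal] at h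
  norm_num at h

theorem seqPrefix_inj {x x' : BitSeq} {n n' : ℕ} (h : seqPrefix x n = seqPrefix x' n') :
    n = n' ∧ ∀ i < n, x i = x' i := by
  have hn : n = n' := by simpa [seqPrefix] using congrArg List.length h
  subst hn
  refine ⟨rfl, fun i hi => ?_⟩
  rw [← getD_map_range x hi, ← getD_map_range x' hi]
  exact congrArg (fun l => List.getD l i false) h

theorem pairString_inj {x y x' y' : BitString} (h : pairString x y = pairString x' y') :
    x = x' ∧ y = y' := by
  have hi : ∀ u v : BitString, (pairString u v).idxOf false = u.length := fun u v => by
    rw [pairString, List.idxOf_append_of_notMem (by simp)]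
    simp
  have hl : x.length = x'.length := by rw [← hi x y, h, hi]
  rw [pairString, pairString, hl, List.append_cancel_left_eq, List.cons.injEq] at h
  exact List.append_inj h.2 hl

/-- There are sequences such that their prefixes and the pairs of their prefixes are
incompressible. -/
theorem exists_incompressible {U : BitString → BitString →. BitString}
    (hU : IsOptimalPrefixMachine U) :
    ∃ y z : BitSeq, ∀ n, n ≤ prefixK U (seqPrefix y n) + 1 ∧ n ≤ prefixK U (seqPrefix z n) + 1 ∧
      2 * n ≤ prefixK U (pairString (seqPrefix y n) (seqPrefix z n)) + 1 := by
  have h1 : ∀ b : Bool, _ := fun b => coinMeasure_compressible_le hU.toIsPrefixMachine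
    (fun ω : Bool × ℕ → Bool => seqPrefix fun i => ω (b, i)) (fun n => {b} ×ˢ Finset.range n) <| by
    intro ω ω' n n' h
    obtain ⟨hn, h⟩ := seqPrefix_inj h
    exact ⟨hn, by
      rintro ⟨b', i⟩ hi
      obtain ⟨rfl, hin⟩ : b' = b ∧ i < n := by
        simpa only [Finset.mem_product, Finset.mem_singleton, Finset.mem_range] using hi
      exact h i hin⟩
  have h2 := coinMeasure_compressible_le hU.toIsPrefixMachine
    (fun (ω : Bool × ℕ → Bool) n => pairString (seqPrefix (fun i => ω (false, i)) n)
      (seqPrefix (fun i => ω (true, i)) n)) (fun n => Finset.univ ×ˢ Finset.range n) <| by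
    intro ω ω' n n' h
    obtain ⟨hy, hz⟩ := pairString_inj h
    obtain ⟨hn, hy⟩ := seqPrefix_inj hy
    obtain ⟨-, hz⟩ := seqPrefix_inj hz
    refine ⟨hn, ?_⟩
    rintro ⟨b, i⟩ hi
    have hin : i < n := Finset.mem_range.1 (Finset.mem_product.1 hi).2
    cases b
    · exact hy i hin
    · exact hz i hin
  obtain ⟨ω, hω₁, hω₂, hω₃⟩ := exists_notMem_of_measure_le (h1 false) (h1 true) h2
  have key : ∀ (x : BitString) (k : ℕ), (∀ p, x ∈ U p [] → ¬ p.length + 2 ≤ k) →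
      k ≤ prefixK U x + 1 := by
    intro x k h
    obtain ⟨p, hp, hx⟩ := exists_program_condK hU x []
    have := h p hx
    rw [prefixK]
    omega
  refine ⟨fun i => ω (false, i), fun i => ω (true, i), fun n => ⟨?_, ?_, ?_⟩⟩
  · exact key _ _ fun p hp hn => hω₁ ⟨n, p, hp, by simpa using hn⟩
  · exact key _ _ fun p hp hn => hω₂ ⟨n, p, hp, by simpa using hn⟩
  · exact key _ _ fun p hp hn => hω₃ ⟨n, p, hp, by simpa using hn⟩

/-! ### Logarithmic error terms -/

theorem size_le_logb {n : ℕ} (hn : 1 ≤ n) : (n.size : ℝ) ≤ Real.logb 2 n + 1 := by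
  have h : 2 ^ (n.size - 1) ≤ n := by
    rw [← Nat.lt_size]
    have := Nat.size_pos.2 hn
    omega
  have h' : ((n.size - 1 : ℕ) : ℝ) ≤ Real.logb 2 n := by
    rw [Real.le_logb_iff_rpow_le one_lt_two (by exact_mod_cast hn), Real.rpow_natCast]
    exact_mod_cast h
  have : (n.size : ℝ) ≤ ((n.size - 1 : ℕ) : ℝ) + 1 := by
    exact_mod_cast (by omega : n.size ≤ n.size - 1 + 1)
  linarith

theorem logb_le_size (n : ℕ) : Real.logb 2 n ≤ n.size := by
  rcases Nat.eq_zero_or_pos n with rfl | hn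
  · simp
  · rw [Real.logb_le_iff_le_rpow one_lt_two (by exact_mod_cast hn), Real.rpow_natCast]
    exact_mod_cast n.lt_size_self.le

theorem prefixK_seqPrefix_le {U : BitString → BitString →. BitString}
    (hU : IsOptimalPrefixMachine U) :
    ∃ D : ℕ, ∀ (x : BitSeq) (n : ℕ), prefixK U (seqPrefix x n) ≤ n + D * (n.size + 1) := by
  obtain ⟨c, hc⟩ := exists_condK_le_length hU (F := fun d => d.2.2)
    (Computable.snd.comp Computable.snd)
  refine ⟨4 + c, fun x n => ?_⟩
  have h := hc [] 0 (seqPrefix x n)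
  have hl : (seqPrefix x n).length = n := by simp [seqPrefix]
  have hs := size_pair_le n 0
  rw [hl] at h
  simp only [Nat.size_zero, zero_le, max_eq_left] at hs h
  rw [prefixK]
  nlinarith

theorem prefixK_pairString_le {U : BitString → BitString →. BitString}
    (hU : IsOptimalPrefixMachine U) :
    ∃ D : ℕ, ∀ (x y : BitSeq) (n : ℕ),
      prefixK U (pairString (seqPrefix x n) (seqPrefix y n)) ≤ 2 * n + D * (n.size + 1) := by
  obtain ⟨c, hc⟩ := exists_condK_le_length hU
    (F := fun d => pairString (d.2.2.take d.2.1) (d.2.2.drop d.2.1))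
    (pairString_computable.comp
      (Primrec.list_take.comp (Primrec.fst.comp Primrec.snd)
        (Primrec.snd.comp Primrec.snd)).to_comp
      (Primrec.list_drop.comp (Primrec.fst.comp Primrec.snd)
        (Primrec.snd.comp Primrec.snd)).to_comp)
  refine ⟨4 + c, fun x y n => ?_⟩
  have hl : ∀ x, (seqPrefix x n).length = n := by simp [seqPrefix]
  have h := hc [] n (seqPrefix x n ++ seqPrefix y n)
  have hs := size_pair_le (n + n) n
  have hs' := size_two_mul_le (n := n) (k := n + n) (by omega)
  simp only [List.take_left' (hl x), List.drop_left' (hl x), List.length_append, hl] at h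
  rw [prefixK]
  have : (Nat.pair (n + n) n).size ≤ 2 * (n.size + 1) := by omega
  nlinarith

theorem exists_random_independent {U : BitString → BitString →. BitString}
    (hU : IsOptimalPrefixMachine U) :
    ∃ y z : BitSeq, IsKRandom U y ∧ IsKRandom U z ∧ AreKIndependent U y z := by
  obtain ⟨y, z, h⟩ := exists_incompressible hU
  obtain ⟨D₁, h₁⟩ := prefixK_seqPrefix_le hU
  obtain ⟨D₂, h₂⟩ := prefixK_pairString_le hU
  refine ⟨y, z, ⟨1, fun n => (h n).1⟩, ⟨1, fun n => (h n).2.1⟩,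
    2 * D₁ + D₂ + 2, 2 * (2 * D₁ + D₂ + 2), fun n hn => ?_⟩
  have hs := size_le_logb hn
  obtain ⟨hy, hz, hp⟩ := h n
  have hy' := h₁ y n
  have hz' := h₁ z n
  have hp' := h₂ y z n
  have hlog : (0 : ℝ) ≤ n.size := Nat.cast_nonneg _
  have hD : ((2 * D₁ + D₂ + 2 : ℕ) : ℝ) * (n.size + 1) ≤
      (2 * D₁ + D₂ + 2) * Real.logb 2 n + 2 * (2 * D₁ + D₂ + 2) := by
    push_cast
    have : (0 : ℝ) ≤ 2 * D₁ + D₂ + 2 := by positivity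
    nlinarith
  refine le_trans ?_ hD
  rw [abs_le]
  have e1 : prefixK U (seqPrefix y n) + prefixK U (seqPrefix z n) ≤
      prefixK U (pairString (seqPrefix y n) (seqPrefix z n)) +
        (2 * D₁ + D₂ + 2) * (n.size + 1) := by nlinarith
  have e2 : prefixK U (pairString (seqPrefix y n) (seqPrefix z n)) ≤
      prefixK U (seqPrefix y n) + prefixK U (seqPrefix z n) +
        (2 * D₁ + D₂ + 2) * (n.size + 1) := by nlinarith
  have e1' : (prefixK U (seqPrefix y n) + prefixK U (seqPrefix z n) : ℝ) ≤
      prefixK U (pairString (seqPrefix y n) (seqPrefix z n)) +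
        (2 * D₁ + D₂ + 2 : ℕ) * (n.size + 1) := mod_cast e1
  have e2' : (prefixK U (pairString (seqPrefix y n) (seqPrefix z n)) : ℝ) ≤
      prefixK U (seqPrefix y n) + prefixK U (seqPrefix z n) +
        (2 * D₁ + D₂ + 2 : ℕ) * (n.size + 1) := mod_cast e2
  constructor <;> linarith

/-- Prefixes of random independent sequences have the largest possible joint complexity, up to a
logarithmic term. -/
theorem two_mul_le_prefixK_pairString {U : BitString → BitString →. BitString} {y z : BitSeq}
    (hy : IsKRandom U y) (hz : IsKRandom U z) (hyz : AreKIndependent U y z) :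
    ∃ D : ℕ, ∀ n : ℕ, 2 * n ≤
      prefixK U (pairString (seqPrefix y n) (seqPrefix z n)) + D * (n.size + 1) := by
  obtain ⟨k, hk⟩ := hy
  obtain ⟨k', hk'⟩ := hz
  obtain ⟨C, B, h⟩ := hyz
  obtain ⟨D, hD⟩ := exists_nat_ge (|C| + |B|)
  refine ⟨D + k + k', fun n => ?_⟩
  rcases Nat.eq_zero_or_pos n with rfl | hn
  · simp
  have h1 := hk n
  have h2 := hk' n
  have h3 := (abs_le.1 (h n hn)).1
  have hlog : (0 : ℝ) ≤ Real.logb 2 n := Real.logb_nonneg one_lt_two (by exact_mod_cast hn)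
  have h4 : C * Real.logb 2 n + B ≤ D * (n.size + 1) := by
    have e1 : C * Real.logb 2 n ≤ |C| * n.size :=
      mul_le_mul (le_abs_self C) (logb_le_size n) hlog (abs_nonneg C)
    have e2 := le_abs_self B
    have e3 : (0 : ℝ) ≤ n.size := Nat.cast_nonneg _
    nlinarith [abs_nonneg C, abs_nonneg B]
  have h5 : prefixK U (seqPrefix y n) + prefixK U (seqPrefix z n) ≤
      prefixK U (pairString (seqPrefix y n) (seqPrefix z n)) + D * (n.size + 1) := by
    have : (prefixK U (seqPrefix y n) + prefixK U (seqPrefix z n) : ℝ) ≤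
      prefixK U (pairString (seqPrefix y n) (seqPrefix z n)) + D * (n.size + 1) := by linarith
    exact_mod_cast this
  nlinarith

/-! ### Reals with bounded partial quotients are badly approximable -/

/-- The tail of a continued fraction with bounded partial quotients has bounded partial
quotients. -/
theorem partDens_inv_fract {γ A : ℝ}
    (h : ∀ (n : ℕ) (q : ℝ), (GenContFract.of γ).partDens.get? n = some q → q ≤ A)
    (n : ℕ) (q : ℝ) (hq : (GenContFract.of (Int.fract γ)⁻¹).partDens.get? n = some q) : q ≤ A := by
  refine h (n + 1) q ?_
  rw [GenContFract.partDens, Stream'.Seq.map_get?] at hq ⊢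
  rwa [GenContFract.of_s_succ]

theorem floor_inv_fract_le {γ A : ℝ} (hγ : Irrational γ)
    (h : ∀ (n : ℕ) (q : ℝ), (GenContFract.of γ).partDens.get? n = some q → q ≤ A) :
    (⌊(Int.fract γ)⁻¹⌋ : ℝ) ≤ A := by
  refine h 0 _ ?_
  have h0 := GenContFract.of_s_head (K := ℝ) (v := γ)
    (fun h0 => hγ ⟨⌊γ⌋, by rw [Int.fract, sub_eq_zero] at h0; simpa using h0.symm⟩)
  rw [GenContFract.partDens, Stream'.Seq.map_get?]
  change Option.map _ (GenContFract.of γ).s.head = _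
  rw [h0]
  rfl

theorem irrational_fract {γ : ℝ} (hγ : Irrational γ) : Irrational (Int.fract γ) :=
  hγ.sub_intCast ⌊γ⌋

/-- The quantity `|q ξ - p| (q ω + p) / (ξ + ω)`, with `ξ` the fractional part of `γ`, is invariant
under the step `ξ ↦ 1/ξ - a`, `ω ↦ 1/ω + a`, `(q, p) ↦ (p, q - p a)` of the continued fraction
algorithm, where `a` is the integer part of `1/ξ`. Since `q + p` decreases, the algorithm reaches a
case where the lower bound is obvious. -/
theorem add_le_mul_abs_mul_fract_sub {A : ℝ} (hA : 1 ≤ A) (n : ℕ) :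
    ∀ (γ ω : ℝ) (q p : ℕ), q + p ≤ n → 1 ≤ q → Irrational γ → 1 ≤ ω →
      (∀ (n : ℕ) (a : ℝ), (GenContFract.of γ).partDens.get? n = some a → a ≤ A) →
      Int.fract γ + ω ≤ (A + 2) * (|q * Int.fract γ - p| * (q * ω + p)) := by
  induction n with
  | zero => intro γ ω q p h1 h2; omega
  | succ n ih =>
    intro γ ω q p hn hq hγ hω hdens
    have hξ0 : 0 < Int.fract γ := Int.fract_pos.2 (hγ.ne_int _)
    have hξ1 : Int.fract γ < 1 := Int.fract_lt_one γ
    have hfl := floor_inv_fract_le hγ hdens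
    have hdens' := partDens_inv_fract hdens
    have hirr : Irrational (Int.fract γ)⁻¹ := (irrational_fract hγ).inv
    set ξ := Int.fract γ with hξ
    have hq' : (1 : ℝ) ≤ q := by exact_mod_cast hq
    have hξinv : ξ⁻¹ < A + 1 := (Int.lt_floor_add_one _).trans_le (by linarith)
    have hξA : 1 < (A + 1) * ξ := by
      rwa [inv_eq_one_div, div_lt_iff₀ hξ0] at hξinv
    -- the bound in the terminal cases
    have hbase : ξ + ω ≤ (A + 2) * (ξ * ω) := by nlinarith
    rcases Nat.eq_zero_or_pos p with rfl | hp
    · have h1 : ξ ≤ |q * ξ - (0 : ℕ)| := by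
        rw [Nat.cast_zero, sub_zero, abs_of_pos (by positivity)]; nlinarith
      have h2 : ω ≤ q * ω + (0 : ℕ) := by rw [Nat.cast_zero, add_zero]; nlinarith
      refine hbase.trans ?_
      gcongr
    have hp' : (1 : ℝ) ≤ p := by exact_mod_cast hp
    obtain ⟨a, ha⟩ : ∃ a : ℕ, ⌊ξ⁻¹⌋ = a :=
      Int.eq_ofNat_of_zero_le (Int.floor_nonneg.2 (by positivity))
    have ha1 : 1 ≤ a := by
      have : (1 : ℤ) ≤ ⌊ξ⁻¹⌋ := Int.le_floor.2 (by
        rw [Int.cast_one]; exact (one_lt_inv₀ hξ0).2 hξ1 |>.le)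
      omega
    have hfr : Int.fract ξ⁻¹ = ξ⁻¹ - a := by rw [Int.fract, ha, Int.cast_natCast]
    have hfr0 : 0 ≤ Int.fract ξ⁻¹ := Int.fract_nonneg _
    -- if `q < p a`, then `p / ξ - q` is at least one
    rcases lt_or_ge q (p * a) with hlt | hge
    · have hlt' : (q : ℝ) + 1 ≤ p * a := by exact_mod_cast hlt
      have h1 : ξ ≤ |q * ξ - p| := by
        rw [abs_sub_comm]
        refine le_trans ?_ (le_abs_self _)
        have : (a : ℝ) * ξ ≤ 1 := by
          have := mul_le_mul_of_nonneg_right (show (a : ℝ) ≤ ξ⁻¹ by linarith) hξ0.le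
          rwa [inv_mul_cancel₀ hξ0.ne'] at this
        nlinarith
      have h2 : ω ≤ q * ω + p := by nlinarith
      refine hbase.trans ?_
      gcongr
    · have hmul : p ≤ p * a := Nat.le_mul_of_pos_right p ha1
      have ha1' : (1 : ℝ) ≤ a := by exact_mod_cast ha1
      have h := ih ξ⁻¹ (ω⁻¹ + a) p (q - p * a) (by omega) hp hirr
        (by have : 0 < ω⁻¹ := by positivity
            linarith) hdens'
      rw [hfr, Nat.cast_sub hge, Nat.cast_mul] at h
      have e1 : ξ⁻¹ - a + (ω⁻¹ + a) = (ξ + ω) / (ξ * ω) := by field_simp; ring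
      have e2 : |p * (ξ⁻¹ - a) - (q - p * a)| = |q * ξ - p| / ξ := by
        rw [← abs_of_pos hξ0, ← abs_div, abs_of_pos hξ0, ← abs_neg]
        congr 1; field_simp; ring
      have e3 : p * (ω⁻¹ + a) + (q - p * a) = (q * ω + p) / ω := by field_simp; ring
      rw [e1, e2, e3, div_mul_div_comm, ← mul_div_assoc] at h
      exact (div_le_div_iff_of_pos_right (by positivity)).1 h

/-- An irrational number with bounded partial quotients is badly approximable. -/
theorem exists_le_mul_abs_mul_sub {γ : ℝ} (hγ : Irrational γ) (h : HasBoundedPartialQuotients γ) :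
    ∃ A : ℕ, ∀ (q : ℕ) (p : ℤ), 1 ≤ q → 1 ≤ A * (q * |q * γ - p|) := by
  obtain ⟨A₀, hA₀⟩ := h
  obtain ⟨A, hA⟩ := exists_nat_ge (max A₀ 1)
  have hA1 : (1 : ℝ) ≤ A := (le_max_right _ _).trans hA
  refine ⟨(A + 2) * 3, fun q p hq => ?_⟩
  have hq' : (1 : ℝ) ≤ q := by exact_mod_cast hq
  have hA2 : (1 : ℝ) ≤ ((A + 2) * 3 : ℕ) := by exact_mod_cast (by omega : 1 ≤ (A + 2) * 3)
  have hξ0 := Int.fract_nonneg γ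
  have hξ1 := Int.fract_lt_one γ
  have heq : q * γ - p = q * Int.fract γ - ((p - q * ⌊γ⌋ : ℤ) : ℝ) := by
    rw [Int.fract]; push_cast; ring
  rw [heq]
  generalize p - q * ⌊γ⌋ = r
  -- for an integer outside `[0, q]` the distance is at least one
  have hfar : 1 ≤ |q * Int.fract γ - (r : ℝ)| →
      1 ≤ (((A + 2) * 3 : ℕ) : ℝ) * (q * |q * Int.fract γ - (r : ℝ)|) := fun h =>
    one_le_mul_of_one_le_of_one_le hA2 (one_le_mul_of_one_le_of_one_le hq' h)
  rcases lt_or_ge r 0 with hr | hr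
  · refine hfar (le_trans ?_ (le_abs_self _))
    have : (r : ℝ) ≤ -1 := by exact_mod_cast (by omega : r ≤ -1)
    nlinarith
  rcases lt_or_ge (q : ℤ) r with hr' | hr'
  · refine hfar ?_
    rw [abs_sub_comm]
    refine le_trans ?_ (le_abs_self _)
    have : (q : ℝ) + 1 ≤ r := by exact_mod_cast hr'
    nlinarith
  obtain ⟨k, rfl⟩ := Int.eq_ofNat_of_zero_le hr
  have hk : (k : ℝ) ≤ q := by exact_mod_cast hr'
  have h := add_le_mul_abs_mul_fract_sub hA1 (q + k) γ 1 q k le_rfl hq hγ le_rfl fun n a ha =>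
    (hA₀ n a ha).trans ((le_max_left _ _).trans hA)
  have h0 := abs_nonneg (q * Int.fract γ - (k : ℝ))
  rw [Int.cast_natCast]
  push_cast
  have : |q * Int.fract γ - (k : ℝ)| * (q * 1 + k) ≤ |q * Int.fract γ - (k : ℝ)| * (3 * q) := by
    gcongr; linarith
  have := mul_le_mul_of_nonneg_left this (show (0 : ℝ) ≤ A + 2 by positivity)
  nlinarith

/-! ### Discrepancy of the multiples of a badly approximable number -/

/-- The points `θ + i γ` for `i < q` are distributed in the circle almost like the multiples of
`1/q`, if `p/q` is a good rational approximation of `γ`: up to a bounded shift, the points scaled by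
`q` are congruent to distinct integers modulo `q`. -/
theorem count_fract_le_of_approx {γ : ℝ} {p : ℤ} {q : ℕ} (hq : 1 ≤ q) (hpq : IsCoprime p (q : ℤ))
    (h : |q * γ - p| * q ≤ 1) (θ : ℝ) {r : ℝ} (hr : 0 ≤ r) :
    (((Finset.range q).filter fun i : ℕ => Int.fract (θ + i * γ) ≤ r).card : ℝ) ≤ q * r + 3 := by
  have hq' : (1 : ℝ) ≤ q := by exact_mod_cast hq
  set f : ℕ → ℤ := fun i => ⌊q * θ⌋ + i * p - q * ⌊θ + i * γ⌋ with hf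
  have hmaps : Set.MapsTo f ((Finset.range q).filter fun i : ℕ => Int.fract (θ + i * γ) ≤ r)
      (Finset.Icc (-1) ⌊q * r + 1⌋) := by
    intro i hi
    obtain ⟨hi, hir⟩ := Finset.mem_filter.1 hi
    have hi : (i : ℝ) ≤ q := by exact_mod_cast (Finset.mem_range.1 hi).le
    -- `f i` differs from `q * fract (θ + i γ)` by a number in `(-2, 1]`
    have hδ : |i * (q * γ - p)| ≤ 1 := by
      rw [abs_mul, abs_of_nonneg (Nat.cast_nonneg i), mul_comm]
      exact le_trans (mul_le_mul_of_nonneg_left hi (abs_nonneg _)) h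
    have heq : (f i : ℝ) = q * Int.fract (θ + i * γ) - Int.fract (q * θ) - i * (q * γ - p) := by
      simp only [hf, Int.fract]; push_cast; ring
    have h1 := abs_le.1 hδ
    have h2 := Int.fract_nonneg (q * θ)
    have h3 := Int.fract_lt_one (q * θ)
    have h4 := Int.fract_nonneg (θ + i * γ)
    have h5 : q * Int.fract (θ + i * γ) ≤ q * r := mul_le_mul_of_nonneg_left hir (by positivity)
    have h6 : 0 ≤ q * Int.fract (θ + i * γ) := by positivity
    refine Finset.mem_coe.2 (Finset.mem_Icc.2 ⟨?_, Int.le_floor.2 (by linarith)⟩)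
    have : (-2 : ℝ) < f i := by linarith
    have : -2 < f i := by exact_mod_cast this
    omega
  have hinj : Set.InjOn f ((Finset.range q).filter fun i : ℕ => Int.fract (θ + i * γ) ≤ r) := by
    intro i hi j hj hij
    have hi := Finset.mem_range.1 (Finset.mem_filter.1 hi).1
    have hj := Finset.mem_range.1 (Finset.mem_filter.1 hj).1
    have hdvd : (q : ℤ) ∣ (i - j) * p :=
      ⟨⌊θ + i * γ⌋ - ⌊θ + j * γ⌋, by simp only [hf] at hij; linarith⟩
    have hdvd : (q : ℤ) ∣ i - j := hpq.symm.dvd_of_dvd_mul_right hdvd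
    have := Int.eq_zero_of_abs_lt_dvd hdvd (by rw [abs_lt]; constructor <;> omega)
    omega
  have hcard := Finset.card_le_card_of_injOn f hmaps hinj
  rw [Int.card_Icc] at hcard
  have hfl : (0 : ℤ) ≤ ⌊q * r + 1⌋ := Int.floor_nonneg.2 (by positivity)
  have hcard' : (((Finset.range q).filter fun i : ℕ => Int.fract (θ + i * γ) ≤ r).card : ℤ) ≤
      ⌊q * r + 1⌋ + 2 := by omega
  have hcard'' : (((Finset.range q).filter fun i : ℕ => Int.fract (θ + i * γ) ≤ r).card : ℝ) ≤
      ⌊q * r + 1⌋ + 2 := by exact_mod_cast hcard'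
  linarith [Int.floor_le (q * r + 1)]

/-- For a badly approximable number, Dirichlet's approximations have denominators in every interval
of bounded ratio. -/
theorem exists_approx {γ : ℝ} {A : ℕ}
    (hγ : ∀ (q : ℕ) (p : ℤ), 1 ≤ q → 1 ≤ A * (q * |q * γ - p|)) {n : ℕ} (hn : 1 ≤ n) :
    ∃ (p : ℤ) (q : ℕ), 1 ≤ q ∧ q ≤ n ∧ n ≤ A * q ∧ IsCoprime p (q : ℤ) ∧
      |q * γ - p| * q ≤ 1 := by
  obtain ⟨r, hr, hden⟩ := Real.exists_rat_abs_sub_le_and_den_le γ hn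
  have hd : (1 : ℝ) ≤ r.den := by exact_mod_cast r.den_pos
  have hn' : (0 : ℝ) < n + 1 := by positivity
  have hb : |r.den * γ - r.num| * (n + 1) ≤ 1 := by
    have e : (r.den : ℝ) * γ - r.num = r.den * (γ - r) := by
      rw [mul_sub, ← Rat.cast_natCast, ← Rat.cast_mul, Rat.den_mul_eq_num, Rat.cast_intCast]
    rw [e, abs_mul, abs_of_pos (by linarith : (0 : ℝ) < r.den)]
    have := mul_le_mul_of_nonneg_left hr (show (0 : ℝ) ≤ (n + 1) * r.den by positivity)
    have e2 : (n + 1) * r.den * (1 / ((n + 1) * r.den)) = (1 : ℝ) :=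
      mul_one_div_cancel (by positivity)
    linarith
  have h0 := abs_nonneg (r.den * γ - r.num)
  have hdn : (r.den : ℝ) ≤ n := by exact_mod_cast hden
  refine ⟨r.num, r.den, r.den_pos, hden, ?_, Int.isCoprime_iff_gcd_eq_one.2 r.reduced, ?_⟩
  · have h1 := hγ r.den r.num r.den_pos
    have h2 : (n + 1 : ℝ) ≤ A * r.den := by
      calc (n + 1 : ℝ) ≤ (n + 1) * (A * (r.den * |r.den * γ - r.num|)) :=
            le_mul_of_one_le_right hn'.le h1
        _ = A * r.den * (|r.den * γ - r.num| * (n + 1)) := by ring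
        _ ≤ A * r.den := mul_le_of_le_one_right (by positivity) hb
    have : n + 1 ≤ A * r.den := by exact_mod_cast h2
    omega
  · nlinarith

theorem card_filter_range_add (P : ℕ → Prop) [DecidablePred P] (m n : ℕ) :
    ((Finset.range (m + n)).filter P).card =
      ((Finset.range m).filter P).card + ((Finset.range n).filter fun i => P (m + i)).card := by
  rw [← Nat.count_eq_card_filter_range, ← Nat.count_eq_card_filter_range,
    ← Nat.count_eq_card_filter_range, Nat.count_add]

/-- Upper bound for the number of points `θ + i γ` in an interval `[0, r]` of the circle: a range of
length `n` is cut into boundedly many blocks to which `count_fract_le_of_approx` applies and a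
remainder of at most half the length. -/
theorem count_fract_le {γ : ℝ} {A : ℕ}
    (hγ : ∀ (q : ℕ) (p : ℤ), 1 ≤ q → 1 ≤ A * (q * |q * γ - p|)) {r : ℝ} (hr : 0 ≤ r) (n : ℕ) :
    ∀ θ : ℝ, (((Finset.range n).filter fun i : ℕ => Int.fract (θ + i * γ) ≤ r).card : ℝ) ≤
      n * r + 3 * A * n.size := by
  induction n using Nat.strong_induction_on with
  | _ n ih =>
    intro θ
    rcases Nat.eq_zero_or_pos n with rfl | hn
    · simp
    obtain ⟨p, q, hq, hqn, hnq, hpq, happ⟩ := exists_approx hγ hn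
    have hblocks : ∀ (k : ℕ) (θ : ℝ),
        (((Finset.range (q * k)).filter fun i : ℕ => Int.fract (θ + i * γ) ≤ r).card : ℝ) ≤
          (q * k : ℕ) * r + 3 * k := by
      intro k
      induction k with
      | zero => simp
      | succ k ihk =>
        intro θ
        rw [Nat.mul_succ, card_filter_range_add]
        have h1 := ihk θ
        have h2 := count_fract_le_of_approx hq hpq happ (θ + (q * k : ℕ) * γ) hr
        simp only [add_assoc, ← add_mul, ← Nat.cast_add] at h2
        push_cast at h1 h2 ⊢
        linarith
    have hdiv := Nat.div_add_mod n q
    have hmod := Nat.mod_lt n hq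
    have hk1 : 1 ≤ n / q := (Nat.one_le_div_iff hq).2 hqn
    have hkA : n / q ≤ A := by
      refine Nat.div_le_of_le_mul ?_
      rw [mul_comm]; exact hnq
    have hhalf : 2 * (n % q) ≤ n := by nlinarith
    have hsize : (n % q).size + 1 ≤ n.size := by
      rcases Nat.eq_zero_or_pos (n % q) with h0 | h0
      · rw [h0, Nat.size_zero]; exact Nat.size_pos.2 hn
      · have : 2 ^ ((n % q).size - 1) ≤ n % q := by
          rw [← Nat.lt_size]
          have := Nat.size_pos.2 h0
          omega
        rw [Nat.add_one_le_iff, Nat.lt_size]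
        have hs := Nat.size_pos.2 h0
        obtain ⟨t, ht⟩ := Nat.exists_eq_add_of_le' hs
        rw [ht, pow_succ]
        rw [ht, Nat.add_sub_cancel] at this
        omega
    have h1 := hblocks (n / q) θ
    have h2 := ih (n % q) (by omega) (θ + (q * (n / q) : ℕ) * γ)
    simp only [add_assoc, ← add_mul, ← Nat.cast_add] at h2
    have h3 := card_filter_range_add (fun i : ℕ => Int.fract (θ + i * γ) ≤ r) (q * (n / q)) (n % q)
    rw [hdiv] at h3
    rw [h3]
    have h4 : (n : ℝ) = (q * (n / q) : ℕ) + (n % q : ℕ) := by exact_mod_cast hdiv.symm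
    have h5 : ((n / q : ℕ) : ℝ) ≤ A := by exact_mod_cast hkA
    have h6 : ((n % q).size : ℝ) + 1 ≤ n.size := by exact_mod_cast hsize
    have h7 : (0 : ℝ) ≤ A := Nat.cast_nonneg _
    have h8 : A * ((n % q).size + 1 : ℝ) ≤ A * n.size := mul_le_mul_of_nonneg_left h6 h7
    have h9 : (n : ℝ) * r = (q * (n / q) : ℕ) * r + (n % q : ℕ) * r := by rw [h4]; ring
    rw [h9, Nat.cast_add]
    linarith

/-- The discrepancy of the multiples of a badly approximable number is logarithmic. The lower bound
is the upper bound for the complementary interval and for `-γ`. -/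
theorem abs_count_fract_sub_le {γ : ℝ} {A : ℕ}
    (hγ : ∀ (q : ℕ) (p : ℤ), 1 ≤ q → 1 ≤ A * (q * |q * γ - p|)) {r : ℝ} (hr : 0 ≤ r) (hr1 : r ≤ 1)
    (θ : ℝ) (n : ℕ) :
    |(((Finset.range n).filter fun i : ℕ => Int.fract (θ + i * γ) ≤ r).card : ℝ) - n * r| ≤
      3 * A * n.size := by
  have h1 := count_fract_le hγ hr n θ
  have h2 := count_fract_le (γ := -γ) (A := A) (fun q p hq => by
    have := hγ q (-p) hq
    rwa [← abs_neg, show -(q * γ - ((-p : ℤ) : ℝ)) = q * -γ - p by push_cast; ring] at this)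
    (r := 1 - r) (by linarith) n (-θ)
  have h3 := Finset.card_filter_add_card_filter_not (s := Finset.range n)
    (fun i : ℕ => Int.fract (θ + i * γ) ≤ r)
  have h4 : ((Finset.range n).filter fun i : ℕ => ¬ Int.fract (θ + i * γ) ≤ r).card ≤
      ((Finset.range n).filter fun i : ℕ => Int.fract (-θ + i * -γ) ≤ 1 - r).card := by
    refine Finset.card_le_card fun i hi => ?_
    obtain ⟨hi, hir⟩ := Finset.mem_filter.1 hi
    refine Finset.mem_filter.2 ⟨hi, ?_⟩
    rw [not_le] at hir
    rw [show -θ + i * -γ = -(θ + i * γ) by ring, Int.fract_neg (hr.trans_lt hir).ne']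
    linarith
  rw [Finset.card_range] at h3
  have h3' : (((Finset.range n).filter fun i : ℕ => Int.fract (θ + i * γ) ≤ r).card : ℝ) +
      ((Finset.range n).filter fun i : ℕ => ¬ Int.fract (θ + i * γ) ≤ r).card = n := by
    exact_mod_cast h3
  have h4' : (((Finset.range n).filter fun i : ℕ => ¬ Int.fract (θ + i * γ) ≤ r).card : ℝ) ≤
      ((Finset.range n).filter fun i : ℕ => Int.fract (-θ + i * -γ) ≤ 1 - r).card := by
    exact_mod_cast h4
  rw [abs_le]
  constructor <;> linarith

/-! ### Comparing multiples of a computable number modulo one -/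

theorem encode_int_natCast (k : ℕ) : Encodable.encode (k : ℤ) = 2 * k := by
  change Equiv.natSumNatEquivNat (Sum.inl k) = _
  simp [Equiv.natSumNatEquivNat_apply]

theorem encode_int_negSucc (k : ℕ) : Encodable.encode (Int.negSucc k) = 2 * k + 1 := by
  change Equiv.natSumNatEquivNat (Sum.inr k) = _
  simp [Equiv.natSumNatEquivNat_apply]

theorem int_ofNat_primrec : Primrec Int.ofNat :=
  Primrec.encode_iff.1 <| (Primrec.nat_mul.comp (Primrec.const 2) Primrec.id).of_eq fun k =>
    (encode_int_natCast k).symm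

theorem two_pow_primrec : Primrec fun n : ℕ => 2 ^ n :=
  (Primrec₂.unpaired'.1 Nat.Primrec.pow).comp (Primrec.const 2) Primrec.id

/-- The residue of an integer modulo a power of two is computable. -/
theorem emod_two_pow_primrec : Primrec₂ fun (z : ℤ) (n : ℕ) => (z % (2 ^ n : ℕ)).toNat := by
  have he : Primrec fun a : ℤ × ℕ => Encodable.encode a.1 := Primrec.encode.comp Primrec.fst
  have hp : Primrec fun a : ℤ × ℕ => 2 ^ a.2 := two_pow_primrec.comp Primrec.snd
  have hm : Primrec fun a : ℤ × ℕ => (Encodable.encode a.1).div2 % 2 ^ a.2 :=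
    Primrec.nat_mod.comp (Primrec.nat_div2.comp he) hp
  refine (Primrec.cond (Primrec.nat_bodd.comp he)
    (Primrec.nat_sub.comp (Primrec.nat_sub.comp hp (Primrec.const 1)) hm) hm).of_eq ?_
  rintro ⟨k | k, n⟩
  · simp only [Int.ofNat_eq_natCast, encode_int_natCast, Nat.bodd_mul, Nat.bodd_two, Bool.false_and,
      cond_false, Nat.div2_val, Nat.mul_div_cancel_left k two_pos]
    norm_cast
  · have hdiv : (2 * k + 1) / 2 = k := by omega
    have hlt := Nat.mod_lt k (Nat.two_pow_pos n)
    simp only [encode_int_negSucc, Nat.bodd_add, Nat.bodd_mul, Nat.bodd_two, Bool.false_and,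
      Nat.bodd_one, Bool.false_xor, Bool.cond_true, Nat.div2_val, hdiv]
    rw [Int.negSucc_emod _ (by exact_mod_cast Nat.two_pow_pos n)]
    omega

/-- A computable number has computable dyadic approximations modulo one. -/
theorem exists_computable_approx {γ : ℝ} (h : IsComputableReal γ) :
    ∃ g : ℕ → ℕ, Computable g ∧ ∀ n, ∃ k : ℤ, |γ - k - g n / 2 ^ n| ≤ 1 / 2 ^ n := by
  obtain ⟨num, hnum, happ⟩ := h
  refine ⟨fun n => (num n % (2 ^ n : ℕ)).toNat,
    emod_two_pow_primrec.to_comp.comp hnum Computable.id, fun n => ⟨num n / (2 ^ n : ℕ), ?_⟩⟩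
  have hpos : (0 : ℝ) < 2 ^ n := by positivity
  have h1 : (((num n % (2 ^ n : ℕ)).toNat : ℤ) : ℝ) = num n - 2 ^ n * (num n / (2 ^ n : ℕ) : ℤ) := by
    rw [Int.toNat_of_nonneg (Int.emod_nonneg _ (by positivity)), Int.emod_def]
    push_cast
    ring
  rw [Int.cast_natCast] at h1
  convert happ n using 2
  rw [h1]
  field_simp
  ring

/-- The mask that selects the positions `i` such that `(i + 1) γ mod 1` is at most
`(j + 1) γ mod 1`; the index `e` of the mask is `j + 1`, and the mask with index `0` is empty. -/
noncomputable def rotationMask (γ : ℝ) (e i : ℕ) : Bool :=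
  open Classical in decide (1 ≤ e ∧ Int.fract (((i : ℝ) + 1) * γ) ≤ Int.fract ((e : ℝ) * γ))

/-- The distance of multiples of a badly approximable number to the integers decides the
fractional part of an approximation. -/
theorem fract_mul_approx {γ δ G : ℝ} {A a N : ℕ} {k : ℤ}
    (hγ : ∀ (q : ℕ) (p : ℤ), 1 ≤ q → 1 ≤ A * (q * |q * γ - p|)) (ha : 1 ≤ a)
    (hk : γ = k + G + δ) (hδ : |δ| ≤ 1 / 2 ^ N) (hN : A * a * a < 2 ^ N) :
    Int.fract (a * G) = Int.fract (a * γ) - a * δ := by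
  have ha' : (1 : ℝ) ≤ a := by exact_mod_cast ha
  have hN' : (A * a * a : ℝ) < 2 ^ N := by exact_mod_cast hN
  have hpos : (0 : ℝ) < 2 ^ N := by positivity
  have hA : (0 : ℝ) ≤ A := Nat.cast_nonneg A
  have hδ' : |δ| * 2 ^ N ≤ 1 := (le_div_iff₀ hpos).1 hδ
  -- `a γ` is at distance more than `a |δ|` from all integers
  have hgap : ∀ p : ℤ, a * |δ| < |a * γ - p| := by
    intro p
    have h1 := hγ a p ha
    have h0 := abs_nonneg (a * γ - p)
    have hd := abs_nonneg δ
    by_contra! hle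
    have h2 : (1 : ℝ) ≤ A * a * a * |δ| := by
      calc (1 : ℝ) ≤ A * (a * |a * γ - p|) := h1
        _ ≤ A * (a * (a * |δ|)) := by gcongr
        _ = A * a * a * |δ| := by ring
    rcases hd.eq_or_lt with hd | hd
    · rw [← hd] at h2; linarith
    · nlinarith
  have habs : |a * δ| = a * |δ| := by rw [abs_mul, abs_of_nonneg (by linarith)]
  have hb := abs_le.1 habs.le
  have h1 := hgap ⌊a * γ⌋
  have h2 := hgap (⌊a * γ⌋ + 1)
  have hf : (a * γ - ⌊a * γ⌋ : ℝ) = Int.fract (a * γ) := rfl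
  have hf1 := Int.fract_lt_one (a * γ)
  rw [hf, abs_of_nonneg (Int.fract_nonneg (a * γ))] at h1
  rw [Int.cast_add, Int.cast_one, ← sub_sub, hf, abs_sub_comm, abs_of_pos (sub_pos.2 hf1)] at h2
  refine Int.fract_eq_iff.2 ⟨by linarith, by linarith, ⌊a * γ⌋ - a * k, ?_⟩
  have hG : G = γ - k - δ := by rw [hk]; ring
  rw [hG, ← hf]
  push_cast
  ring

/-- A sufficiently good dyadic approximation orders two multiples modulo one correctly. -/
theorem fract_le_fract_iff_mod_le {γ : ℝ} {A a b N g : ℕ} {k : ℤ}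
    (hγ : ∀ (q : ℕ) (p : ℤ), 1 ≤ q → 1 ≤ A * (q * |q * γ - p|)) (ha : 1 ≤ a) (hb : 1 ≤ b)
    (hg : |γ - k - g / 2 ^ N| ≤ 1 / 2 ^ N) (hN : A * (a + b) * (a + b) < 2 ^ N) :
    Int.fract (a * γ) ≤ Int.fract (b * γ) ↔ a * g % 2 ^ N ≤ b * g % 2 ^ N := by
  have hpos : (0 : ℝ) < 2 ^ N := by positivity
  set δ := γ - k - g / 2 ^ N with hδ
  have hk : γ = k + g / 2 ^ N + δ := by rw [hδ]; ring
  clear_value δ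
  have hmod : ∀ c : ℕ, Int.fract (c * (g / 2 ^ N : ℝ)) = (c * g % 2 ^ N : ℕ) / 2 ^ N := fun c => by
    rw [← mul_div_assoc]
    have := Int.fract_div_natCast_eq_div_natCast_mod (k := ℝ) (m := c * g) (n := 2 ^ N)
    push_cast at this ⊢
    exact this
  have hfa := fract_mul_approx hγ ha hk hg (lt_of_le_of_lt (by gcongr <;> omega) hN)
  have hfb := fract_mul_approx hγ hb hk hg (lt_of_le_of_lt (by gcongr <;> omega) hN)
  rcases eq_or_ne a b with rfl | hab
  · simp
  have hiff : a * g % 2 ^ N ≤ b * g % 2 ^ N ↔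
      Int.fract (a * (g / 2 ^ N : ℝ)) ≤ Int.fract (b * (g / 2 ^ N : ℝ)) := by
    rw [hmod, hmod, div_le_div_iff_of_pos_right hpos, Nat.cast_le]
  rw [hiff, hfa, hfb]
  -- the two fractional parts differ by more than the error of the approximation
  have hgap : (a + b) * |δ| < |Int.fract (a * γ) - Int.fract (b * γ)| := by
    have key : ∀ a b : ℕ, b < a → A * (a + b) * (a + b) < 2 ^ N →
        (a + b) * |δ| < |Int.fract (a * γ) - Int.fract (b * γ)| := by
      intro a b hlt hN
      have h1 := hγ (a - b) (⌊a * γ⌋ - ⌊b * γ⌋) (by omega)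
      have heq : ((a - b : ℕ) : ℝ) * γ - (⌊a * γ⌋ - ⌊b * γ⌋ : ℤ) =
          Int.fract (a * γ) - Int.fract (b * γ) := by
        rw [Int.fract, Int.fract, Nat.cast_sub hlt.le]; push_cast; ring
      rw [heq] at h1
      have hN' : (A * (a + b) * (a + b) : ℝ) < 2 ^ N := by exact_mod_cast hN
      have hδ' : |δ| * 2 ^ N ≤ 1 := (le_div_iff₀ hpos).1 hg
      have hd := abs_nonneg δ
      by_contra! hle
      have hsub : ((a - b : ℕ) : ℝ) ≤ a + b := by exact_mod_cast (by omega : a - b ≤ a + b)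
      have h2 : (1 : ℝ) ≤ A * (a + b) * (a + b) * |δ| := by
        calc (1 : ℝ) ≤ A * (((a - b : ℕ) : ℝ) * |Int.fract (a * γ) - Int.fract (b * γ)|) := h1
          _ ≤ A * ((a + b) * ((a + b) * |δ|)) := by gcongr
          _ = A * (a + b) * (a + b) * |δ| := by ring
      rcases hd.eq_or_lt with hd | hd
      · rw [← hd] at h2; linarith
      · nlinarith
    rcases lt_or_gt_of_ne hab with h | h
    · rw [add_comm, abs_sub_comm]
      exact key b a h (by rwa [add_comm b a])
    · exact key a b h hN
  have hd := abs_le.1 (le_refl |δ|)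
  have ha' : (0 : ℝ) ≤ a := Nat.cast_nonneg a
  have hb' : (0 : ℝ) ≤ b := Nat.cast_nonneg b
  have e1 := mul_le_mul_of_nonneg_left hd.1 ha'
  have e2 := mul_le_mul_of_nonneg_left hd.2 ha'
  have e3 := mul_le_mul_of_nonneg_left hd.1 hb'
  have e4 := mul_le_mul_of_nonneg_left hd.2 hb'
  rcases lt_abs.1 hgap with h | h <;> constructor <;> intro h' <;> nlinarith

theorem rotationMask_computable {γ : ℝ} {A : ℕ}
    (hγ : ∀ (q : ℕ) (p : ℤ), 1 ≤ q → 1 ≤ A * (q * |q * γ - p|)) (hc : IsComputableReal γ) :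
    Computable₂ (rotationMask γ) := by
  obtain ⟨g, hg, happ⟩ := exists_computable_approx hc
  have hN : Primrec fun a : ℕ × ℕ => A + 2 * (a.2 + 1 + a.1) :=
    Primrec.nat_add.comp (Primrec.const A) (Primrec.nat_mul.comp (Primrec.const 2)
      (Primrec.nat_add.comp (Primrec.succ.comp Primrec.snd) Primrec.fst))
  have hgN : Computable fun a : ℕ × ℕ => g (A + 2 * (a.2 + 1 + a.1)) := hg.comp hN.to_comp
  have hpow : Computable fun a : ℕ × ℕ => 2 ^ (A + 2 * (a.2 + 1 + a.1)) :=
    (two_pow_primrec.comp hN).to_comp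
  have hcomp : Computable₂ fun e i : ℕ => decide (1 ≤ e) &&
      decide ((i + 1) * g (A + 2 * (i + 1 + e)) % 2 ^ (A + 2 * (i + 1 + e)) ≤
        e * g (A + 2 * (i + 1 + e)) % 2 ^ (A + 2 * (i + 1 + e))) := by
    refine Primrec.and.to_comp.comp
      (Primrec.nat_le.decide.comp (Primrec.const 1) Primrec.fst).to_comp
      (Primrec.nat_le.decide.to_comp.comp
      (Primrec.nat_mod.to_comp.comp (Primrec.nat_mul.to_comp.comp
        (Primrec.succ.comp Primrec.snd).to_comp hgN) hpow)
      (Primrec.nat_mod.to_comp.comp (Primrec.nat_mul.to_comp.comp Computable.fst hgN) hpow))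
  refine hcomp.of_eq ?_
  rintro ⟨e, i⟩
  simp only [rotationMask]
  rcases Nat.eq_zero_or_pos e with rfl | he
  · simp
  obtain ⟨k, hk⟩ := happ (A + 2 * (i + 1 + e))
  have h := fract_le_fract_iff_mod_le hγ (a := i + 1) (b := e) (by omega) he hk (by
    have h1 : A < 2 ^ A := Nat.lt_two_pow_self
    have h2 : i + 1 + e < 2 ^ (i + 1 + e) := Nat.lt_two_pow_self
    rw [pow_add, two_mul, pow_add, mul_assoc]
    exact Nat.mul_lt_mul_of_lt_of_le h1 (Nat.mul_le_mul h2.le h2.le) (by positivity))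
  push_cast at h
  rw [← Bool.decide_and, decide_eq_decide, h]

/-- Among the first `s` points of the rotation, those below a real threshold are those below one of
the points, or none. So an incomputable threshold can be replaced by an index, given by `O(log s)`
bits. -/
theorem exists_rotationMask_eq (γ r : ℝ) (s : ℕ) :
    ∃ e ≤ s, ∀ i < s, (rotationMask γ e i = true ↔ Int.fract (((i : ℝ) + 1) * γ) ≤ r) := by
  classical
  set I := (Finset.range s).filter fun i : ℕ => Int.fract (((i : ℝ) + 1) * γ) ≤ r with hI
  rcases I.eq_empty_or_nonempty with h | h
  · refine ⟨0, Nat.zero_le _, fun i hi => ?_⟩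
    have hn : i ∉ I := by rw [h]; exact Finset.notMem_empty i
    simp only [hI, Finset.mem_filter, Finset.mem_range, not_and] at hn
    simp [rotationMask, hn hi]
  · obtain ⟨j, hj, hmax⟩ := I.exists_max_image (fun i : ℕ => Int.fract (((i : ℝ) + 1) * γ)) h
    obtain ⟨hjs, hjr⟩ := Finset.mem_filter.1 hj
    refine ⟨j + 1, Finset.mem_range.1 hjs, fun i hi => ?_⟩
    simp only [rotationMask, Nat.cast_add, Nat.cast_one, decide_eq_true_eq, le_add_iff_nonneg_left,
      zero_le, true_and]
    exact ⟨fun hle => hle.trans hjr,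
      fun hir => hmax i (Finset.mem_filter.2 ⟨Finset.mem_range.2 hi, hir⟩)⟩

/-! ### The number `1 + √2` -/

theorem irrational_one_add_sqrt_two : Irrational (1 + √2) := by
  simpa using irrational_sqrt_two.natCast_add 1

theorem isComputableReal_one_add_sqrt_two : IsComputableReal (1 + √2) := by
  refine ⟨fun n => Int.ofNat (2 ^ n + Nat.sqrt (2 * (2 ^ n * 2 ^ n))),
    (int_ofNat_primrec.comp (Primrec.nat_add.comp two_pow_primrec (Primrec.nat_sqrt.comp
      (Primrec.nat_mul.comp (Primrec.const 2)
        (Primrec.nat_mul.comp two_pow_primrec two_pow_primrec))))).to_comp, fun n => ?_⟩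
  have hpos : (0 : ℝ) < 2 ^ n := by positivity
  have h1 : (Nat.sqrt (2 * (2 ^ n * 2 ^ n)) : ℝ) ≤ √2 * 2 ^ n := by
    refine (Real.nat_sqrt_le_real_sqrt).trans ?_
    push_cast
    rw [Real.sqrt_mul zero_le_two, Real.sqrt_mul_self hpos.le]
  have h2 : √2 * 2 ^ n ≤ (Nat.sqrt (2 * (2 ^ n * 2 ^ n)) : ℝ) + 1 := by
    refine le_trans ?_ Real.real_sqrt_le_nat_sqrt_succ
    push_cast
    rw [Real.sqrt_mul zero_le_two, Real.sqrt_mul_self hpos.le]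
  simp only [Int.ofNat_eq_natCast, Int.cast_natCast]
  push_cast
  rw [show 1 + √2 - (2 ^ n + (Nat.sqrt (2 * (2 ^ n * 2 ^ n)) : ℝ)) / 2 ^ n =
    (√2 * 2 ^ n - Nat.sqrt (2 * (2 ^ n * 2 ^ n))) / 2 ^ n by field_simp; ring, abs_div,
    abs_of_pos hpos, abs_of_nonneg (by linarith)]
  gcongr
  linarith

/-- All partial quotients of `1 + √2` are equal to two. -/
theorem hasBoundedPartialQuotients_one_add_sqrt_two : HasBoundedPartialQuotients (1 + √2) := by
  have hsq : √2 * √2 = 2 := Real.mul_self_sqrt zero_le_two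
  have h1 : 1 < √2 := Real.lt_sqrt_of_sq_lt (by norm_num)
  have h2 : √2 < 2 := by nlinarith
  have hfloor : ⌊1 + √2⌋ = 2 := Int.floor_eq_iff.2 ⟨by norm_num; linarith, by norm_num; linarith⟩
  have hfract : Int.fract (1 + √2) = √2 - 1 := by rw [Int.fract, hfloor]; norm_num; ring
  have hinv : (Int.fract (1 + √2))⁻¹ = 1 + √2 := by
    rw [hfract]
    exact inv_eq_of_mul_eq_one_right (by linarith)
  refine ⟨2, fun n => ?_⟩
  induction n with
  | zero =>
    intro q hq
    have h0 := GenContFract.of_s_head (K := ℝ) (v := 1 + √2) (by rw [hfract]; linarith)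
    rw [hinv, hfloor] at h0
    rw [GenContFract.partDens, Stream'.Seq.map_get?] at hq
    change Option.map _ (GenContFract.of (1 + √2)).s.head = _ at hq
    rw [h0] at hq
    simp only [Option.map_some, Option.some.injEq] at hq
    rw [← hq]
    norm_num
  | succ n ih =>
    intro q hq
    refine ih q ?_
    rw [GenContFract.partDens, Stream'.Seq.map_get?] at hq ⊢
    rwa [GenContFract.of_s_succ, hinv] at hq

/-! ### Scale-embeddings from nested masks -/

theorem maskDist_add_count {m : ℕ → ℕ → Bool} {s e e' : ℕ}
    (h : ∀ i < s, m e i = true → m e' i = true) :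
    maskDist m s e e' + Nat.count (fun i => m e i = true) s =
      Nat.count (fun i => m e' i = true) s := by
  unfold maskDist
  induction s with
  | zero => rfl
  | succ s ih =>
    have ih := ih fun i hi => h i (by omega)
    have hs := h s (by omega)
    simp only [Nat.count_succ]
    cases h1 : m e s <;> cases h2 : m e' s <;> simp_all <;> omega

/-- A family of nested masks whose numbers of selected positions are known up to a logarithmic error
gives a string-embedding. -/
theorem isStringEmbedding_of_masks {U : BitString → BitString →. BitString}
    (hU : IsOptimalPrefixMachine U) {c : ℝ} (hc : 0 ≤ c) {V : Type*} [MetricSpace V]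
    {m : ℕ → ℕ → Bool} (hm : Computable₂ m) {y z : BitSeq} (hy : IsKRandom U y)
    (hz : IsKRandom U z) (hyz : AreKIndependent U y z) {φ : ℕ → V → BitString} (L : ℕ)
    (idx : ℕ → V → ℕ) (hidx : ∀ s v, idx s v ≤ s * L)
    (hφ : ∀ s v, φ s v = mixString m y z (s * L) (idx s v))
    (hnest : ∀ s v w, (∀ i < s * L, m (idx s v) i = true → m (idx s w) i = true) ∨
      ∀ i < s * L, m (idx s w) i = true → m (idx s v) i = true)
    {α : ℕ → V → ℝ} (hα : ∀ s v w, |α s v - α s w| = s * dist v w) {D : ℝ}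
    (hcount : ∀ s v, |(Nat.count (fun i => m (idx s v) i = true) (s * L) : ℝ) - α s v| ≤
      D * ((s * L).size + 1)) :
    IsStringEmbedding U c φ := by
  obtain ⟨D₀, h₀⟩ := two_mul_le_prefixK_pairString hy hz hyz
  obtain ⟨D₁, hD₁, h₁⟩ := exists_abs_complexityDist_sub_maskDist_le hU hc hm h₀
  set C := D₁ + 2 * |D|
  have hC : 0 ≤ C := by positivity
  refine ⟨C, C * (L.size + 2), fun s hs v w => ?_⟩
  have hsize : ((s * L).size : ℝ) + 1 ≤ Real.logb 2 s + (L.size + 2) := by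
    have h1 : (s * L).size ≤ s.size + L.size := by
      rw [Nat.size_le, pow_add]
      exact Nat.mul_lt_mul'' s.lt_size_self L.lt_size_self
    have h1' : ((s * L).size : ℝ) ≤ s.size + L.size := by exact_mod_cast h1
    linarith [size_le_logb hs]
  have hdist : |(maskDist m (s * L) (idx s v) (idx s w) : ℝ) - s * dist v w| ≤
      2 * |D| * ((s * L).size + 1) := by
    have hnn : (0 : ℝ) ≤ (s * L).size + 1 := by positivity
    have hD := mul_le_mul_of_nonneg_right (le_abs_self D) hnn
    have hv := abs_le.1 (hcount s v)
    have hw := abs_le.1 (hcount s w)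
    have habs : (maskDist m (s * L) (idx s v) (idx s w) : ℝ) =
        |(Nat.count (fun i => m (idx s v) i = true) (s * L) : ℝ) -
          Nat.count (fun i => m (idx s w) i = true) (s * L)| := by
      rcases hnest s v w with h | h
      · rw [← maskDist_add_count h, abs_sub_comm, Nat.cast_add, add_sub_cancel_right,
          Nat.abs_cast]
      · rw [maskDist_comm, ← maskDist_add_count h, Nat.cast_add, add_sub_cancel_right,
          Nat.abs_cast]
    rw [habs, ← hα s v w]
    refine (abs_abs_sub_abs_le_abs_sub _ _).trans (abs_le.2 ⟨?_, ?_⟩) <;> linarith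
  rw [hφ, hφ]
  calc _ ≤ _ + _ := abs_sub_le _ (maskDist m (s * L) (idx s v) (idx s w) : ℝ) _
    _ ≤ D₁ * ((s * L).size + 1) + 2 * |D| * ((s * L).size + 1) :=
        add_le_add (h₁ _ _ _ (hidx s v) (hidx s w)) hdist
    _ = C * ((s * L).size + 1) := by ring
    _ ≤ C * (Real.logb 2 s + (L.size + 2)) := mul_le_mul_of_nonneg_left hsize hC
    _ = C * Real.logb 2 s + C * (L.size + 2) := by ring

/-! ### The embeddings of an interval -/

theorem integerWidth_cast {a b : ℝ} (hab : a ≤ b) : (integerWidth a b : ℝ) = ⌈b⌉ - ⌊a⌋ := by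
  have h : 0 ≤ ⌈b⌉ - ⌊a⌋ := sub_nonneg.2
    (by exact_mod_cast (Int.floor_le a).trans (hab.trans (Int.le_ceil b)))
  have : ((integerWidth a b : ℤ) : ℝ) = (⌈b⌉ - ⌊a⌋ : ℤ) := by
    rw [integerWidth, Int.toNat_of_nonneg h]
  simpa using this

theorem unitCoord_mem {a b r : ℝ} (hr : r ∈ Set.Icc a b) :
    0 ≤ unitCoord a b r ∧ unitCoord a b r ≤ 1 := by
  have h1 := (Int.floor_le a).trans hr.1
  have h2 := hr.2.trans (Int.le_ceil b)
  have h3 : (0 : ℝ) ≤ ⌈b⌉ - ⌊a⌋ := by linarith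
  exact ⟨div_nonneg (by linarith) h3, div_le_one_of_le₀ (by linarith) h3⟩

theorem unitCoord_mul {a b r : ℝ} (hr : r ∈ Set.Icc a b) (s : ℕ) :
    unitCoord a b r * (s * integerWidth a b : ℕ) = s * (r - ⌊a⌋) := by
  have h1 := (Int.floor_le a).trans hr.1
  have h2 := hr.2.trans (Int.le_ceil b)
  rw [Nat.cast_mul, integerWidth_cast (hr.1.trans hr.2), unitCoord]
  rcases eq_or_ne ((⌈b⌉ : ℝ) - ⌊a⌋) 0 with h | h
  · have : r - ⌊a⌋ = 0 := by linarith
    rw [this, h]; simp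
  · field_simp

theorem unitCoord_mono {a b r r' : ℝ} (hab : a ≤ b) (h : r ≤ r') :
    unitCoord a b r ≤ unitCoord a b r' := by
  have h3 : (0 : ℝ) ≤ ⌈b⌉ - ⌊a⌋ := by
    rw [← integerWidth_cast hab]; exact Nat.cast_nonneg _
  exact div_le_div_of_nonneg_right (by linarith) h3

theorem count_tail (e s : ℕ) :
    Nat.count (fun i => (!decide (i + 1 < e)) = true) s = s - (e - 1) := by
  induction s with
  | zero => simp
  | succ s ih =>
    rw [Nat.count_succ, ih]
    by_cases h : s + 1 < e
    · simp only [h, decide_true, Bool.not_true, Bool.false_eq_true, if_false]; omega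
    · simp only [h, decide_false, Bool.not_false, if_true]; omega

/-- The strings `y_{<t} z_{t:s}` form a string-embedding: the masks are final segments. -/
theorem isStringEmbedding_unitString {U : BitString → BitString →. BitString}
    (hU : IsOptimalPrefixMachine U) {c : ℝ} (hc : 0 ≤ c) {a b : ℝ} {y z : BitSeq}
    (hy : IsKRandom U y) (hz : IsKRandom U z) (hyz : AreKIndependent U y z) :
    IsStringEmbedding U c fun (s : ℕ) (r : Set.Icc a b) =>
      unitString y z (s * integerWidth a b) (unitCoord a b r) := by
  have hm : Computable₂ fun e i : ℕ => !decide (i + 1 < e) :=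
    (Primrec.not.comp (Primrec.nat_lt.decide.comp (Primrec.succ.comp Primrec.snd)
      Primrec.fst)).to_comp
  have hnn : ∀ (s : ℕ) (r : Set.Icc a b),
      0 ≤ ⌈unitCoord a b r * (s * integerWidth a b : ℕ)⌉ := fun s r =>
    Int.ceil_nonneg (mul_nonneg (unitCoord_mem r.2).1 (Nat.cast_nonneg _))
  have hle : ∀ (s : ℕ) (r : Set.Icc a b),
      ⌈unitCoord a b r * (s * integerWidth a b : ℕ)⌉ ≤ (s * integerWidth a b : ℕ) := fun s r =>
    Int.ceil_le.2 (by
      rw [Int.cast_natCast]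
      exact mul_le_of_le_one_left (Nat.cast_nonneg _) (unitCoord_mem r.2).2)
  refine isStringEmbedding_of_masks hU hc hm hy hz hyz (integerWidth a b)
    (fun s r => ⌈unitCoord a b r * (s * integerWidth a b : ℕ)⌉.toNat) (fun s r => ?_)
    (fun s r => ?_) (fun s r r' => ?_)
    -- `z` is used from position `⌈ρ s L⌉` on, so the number of its bits decreases with the point
    (α := fun s r => (s * integerWidth a b : ℕ) - s * (r - ⌊a⌋)) (fun s r r' => ?_) (D := 1)
    (fun s r => ?_)
  · have := hle s r
    omega
  · refine List.map_congr_left fun i _ => ?_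
    have hnn := hnn s r
    by_cases h : (i : ℤ) + 1 < ⌈unitCoord a b r * (s * integerWidth a b : ℕ)⌉
    · have h' : i + 1 < ⌈unitCoord a b r * (s * integerWidth a b : ℕ)⌉.toNat := by omega
      simp only [h, h', if_true, decide_true, Bool.not_true, cond_false]
    · have h' : ¬ i + 1 < ⌈unitCoord a b r * (s * integerWidth a b : ℕ)⌉.toNat := by omega
      simp only [h, h', if_false, decide_false, Bool.not_false, cond_true]
  · simp only [Bool.not_eq_true', decide_eq_false_iff_not]
    rcases le_total ⌈unitCoord a b r * (s * integerWidth a b : ℕ)⌉.toNat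
      ⌈unitCoord a b r' * (s * integerWidth a b : ℕ)⌉.toNat with h | h
    · exact Or.inr fun i _ hi => by omega
    · exact Or.inl fun i _ hi => by omega
  · rw [Subtype.dist_eq, Real.dist_eq, abs_sub_comm, ← Nat.abs_cast s, ← abs_mul, Nat.abs_cast]
    congr 1
    ring
  · rw [count_tail, ← unitCoord_mul r.2]
    have hnn := hnn s r
    have hle := hle s r
    have h1 := Int.le_ceil (unitCoord a b r * (s * integerWidth a b : ℕ))
    have h2 := Int.ceil_lt_add_one (unitCoord a b r * (s * integerWidth a b : ℕ))
    have h0 := mul_nonneg (unitCoord_mem r.2).1 (Nat.cast_nonneg (s * integerWidth a b))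
    generalize unitCoord a b r * (s * integerWidth a b : ℕ) = x at *
    generalize s * integerWidth a b = n at *
    obtain ⟨t, ht⟩ := Int.eq_ofNat_of_zero_le hnn
    rw [ht] at hle h1 h2 ⊢
    rw [Int.cast_natCast] at h1 h2
    rw [Int.toNat_natCast, Nat.cast_sub (by omega)]
    have ht1 : ((t - 1 : ℕ) : ℝ) ≤ t := by exact_mod_cast Nat.sub_le t 1
    have ht2 : (t : ℝ) ≤ (t - 1 : ℕ) + 1 := by exact_mod_cast (by omega : t ≤ t - 1 + 1)
    have ht3 : ((t - 1 : ℕ) : ℝ) ≤ x := by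
      rcases Nat.eq_zero_or_pos t with rfl | h
      · simpa using h0
      · rw [Nat.cast_sub h]; push_cast; linarith
    have hsz : (0 : ℝ) ≤ n.size := Nat.cast_nonneg _
    rw [abs_le]
    constructor <;> linarith

/-- The sequences obtained from a rotation form a sequence-embedding: for every length the masks are
rotation masks, and the number of selected positions is known by the discrepancy bound. -/
theorem isSequenceEmbeddingWith_unitSequence {U : BitString → BitString →. BitString}
    (hU : IsOptimalPrefixMachine U) {c : ℝ} (hc : 0 ≤ c) {a b : ℝ} (hab : a ≤ b) {y z : BitSeq}
    (hy : IsKRandom U y) (hz : IsKRandom U z) (hyz : AreKIndependent U y z)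
    {γ : ℝ} (hγ : Irrational γ) (hγc : IsComputableReal γ) (hγb : HasBoundedPartialQuotients γ) :
    IsSequenceEmbeddingWith U c
      (fun r : Set.Icc a b => unitSequence y z γ (unitCoord a b r))
      (fun (s : ℕ) (_ : Set.Icc a b) => s * integerWidth a b) := by
  refine ⟨fun _ s t h => Nat.mul_le_mul_right _ h, ⟨integerWidth a b, 1, fun s _ _ => ?_⟩, ?_⟩
  · simp only [pow_one]; exact (mul_comm _ _).le
  obtain ⟨A, hA⟩ := exists_le_mul_abs_mul_sub hγ hγb
  choose idx hidx hmask using fun (s : ℕ) (r : Set.Icc a b) =>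
    exists_rotationMask_eq γ (unitCoord a b r) (s * integerWidth a b)
  refine isStringEmbedding_of_masks hU hc (rotationMask_computable hA hγc) hy hz hyz
    (integerWidth a b) idx hidx (fun s r => ?_) (fun s r r' => ?_)
    (α := fun s r => s * (r - ⌊a⌋)) (fun s r r' => ?_) (D := 3 * A) (fun s r => ?_)
  · refine List.map_congr_left fun i hi => ?_
    have h := hmask s r i (List.mem_range.1 hi)
    rw [unitSequence]
    by_cases hle : Int.fract (((i : ℝ) + 1) * γ) ≤ unitCoord a b r
    · rw [if_pos hle, h.2 hle, cond_true]
    · rw [if_neg hle, Bool.eq_false_iff.2 fun ht => hle (h.1 ht), cond_false]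
  · rcases le_total (r : ℝ) r' with h | h
    · exact Or.inl fun i hi hir =>
        (hmask s r' i hi).2 (((hmask s r i hi).1 hir).trans (unitCoord_mono hab h))
    · exact Or.inr fun i hi hir =>
        (hmask s r i hi).2 (((hmask s r' i hi).1 hir).trans (unitCoord_mono hab h))
  · rw [Subtype.dist_eq, Real.dist_eq, ← Nat.abs_cast s, ← abs_mul, Nat.abs_cast]
    congr 1
    ring
  · have hcard : Nat.count (fun i => rotationMask γ (idx s r) i = true) (s * integerWidth a b) =
        ((Finset.range (s * integerWidth a b)).filter fun i : ℕ =>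
          Int.fract (γ + i * γ) ≤ unitCoord a b r).card := by
      rw [Nat.count_eq_card_filter_range]
      refine congrArg Finset.card (Finset.filter_congr fun i hi => ?_)
      rw [hmask s r i (Finset.mem_range.1 hi), add_mul, one_mul, add_comm]
    obtain ⟨h0, h1⟩ := unitCoord_mem r.2
    have h := abs_count_fract_sub_le hA h0 h1 γ (s * integerWidth a b)
    rw [mul_comm _ (unitCoord a b r), unitCoord_mul r.2] at h
    rw [hcard]
    refine h.trans ?_
    gcongr
    linarith

theorem mainTheorem2
    (U : BitString → BitString →. BitString) (hU : IsOptimalPrefixMachine U)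
    (c : ℝ) (hc : 0 ≤ c) (a b : ℝ) (hab : a ≤ b) :
    (∃ φ : ℕ → Set.Icc a b → BitString, IsStringEmbedding U c φ) ∧
    (∃ φ : Set.Icc a b → BitSeq, IsSequenceEmbedding U c φ) ∧
    (∃ y z : BitSeq, IsKRandom U y ∧ IsKRandom U z ∧ AreKIndependent U y z) ∧
    (∀ y z : BitSeq, IsKRandom U y → IsKRandom U z → AreKIndependent U y z →
      IsStringEmbedding U c
        (fun (s : ℕ) (r : Set.Icc a b) =>
          unitString y z (s * integerWidth a b) (unitCoord a b r)) ∧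
      ∀ γ : ℝ, Irrational γ → IsComputableReal γ → HasBoundedPartialQuotients γ →
        IsSequenceEmbeddingWith U c
          (fun r : Set.Icc a b => unitSequence y z γ (unitCoord a b r))
          (fun (s : ℕ) (_ : Set.Icc a b) => s * integerWidth a b)) := by
  obtain ⟨y, z, hy, hz, hyz⟩ := exists_random_independent hU
  exact ⟨⟨_, isStringEmbedding_unitString hU hc hy hz hyz⟩,
    ⟨_, _, isSequenceEmbeddingWith_unitSequence hU hc hab hy hz hyz irrational_one_add_sqrt_two
      isComputableReal_one_add_sqrt_two hasBoundedPartialQuotients_one_add_sqrt_two⟩,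
    ⟨y, z, hy, hz, hyz⟩,
    fun _ _ hy hz hyz => ⟨isStringEmbedding_unitString hU hc hy hz hyz, fun _ hγ hγc hγb =>
      isSequenceEmbeddingWith_unitSequence hU hc hab hy hz hyz hγ hγc hγb⟩⟩
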